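/- **Theorem 2.4.** Let $A$ be an $n\times n$ complex Hermitian matrix with spectral norm $\|A\|$, and let $\lambda_1,\dots,\lambda_n$ be its eigenvalues, listed with multiplicity. Let $\delta,\omega>0$ be real and $i\ge 0$ an integer, and suppose that the spectrum of $A$ is $(\delta,\omega,i)$-equidistributed: for every finite set $T$ of at most $i$ real numbers, $$\Bigl|\Bigl\{k\in\{1,\dots,n\} : \frac1{|T|}\sum_{t\in T}\log|\lambda_k-t|\ \ge\ \log\omega\Bigr\}\Bigr|\ \ge\ \delta n ,$$ where $\log 0=-\infty$ and, for $T=\emptyset$, the inequality in braces is understood to hold for every $k$ (so that $\delta\le 1$). For a unit vector $u\in\mathbb S^{n-1}\subset\mathbb R^n\subset\mathbb C^n$ let $v_0(u)=u$ and, for $j=0,1,2,\dots$, $$W_j=\operatorname{span}_{\mathbb C}\{v_0(u),\dots,v_j(u)\},\qquad \alpha_j(u)=\langle Av_j(u),v_j(u)\rangle,\qquad \beta_j(u)=\bigl\|\operatorname{Proj}_{W_j^\perp}(Av_j(u))\bigr\|,$$ $$v_{j+1}(u)=\operatorname{Proj}_{W_j^\perp}(Av_j(u))/\beta_j(u)$$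 be the quantities produced by the Lanczos algorithm with input $A$ and start vector $u$; if $\beta_j(u)=0$ the algorithm stops, and we set $v_l(u)=0$, $\alpha_l(u)=\beta_l(u)=0$ for all $l>j$. Let $u$ be uniformly distributed on $\mathbb S^{n-1}$, and let $\tilde\alpha_i$ and $\tilde\beta_i$ be medians of the Jacobi coefficients $\alpha_i(u)$ and $\beta_i(u)$, respectively. Then for all $t>0$ the probabilities $$\mathbf P\bigl[|\alpha_i(u)-\tilde\alpha_i|>t\|A\|\bigr]\quad\text{and}\quad \mathbf P\bigl[|\beta_i(u)-\tilde\beta_i|>t\|A\|\bigr]$$ are both at most $$2\exp\Bigl\{-\frac{\min\{\delta,1/50\}^2}{32}\,n\Bigr\}+2\exp\Bigl\{-\frac1{64}\Bigl(\frac{\omega}{4\|A\|}\Bigr)^{2i}\delta^2t^2n\Bigr\}.$$ (If $A=0$ the hypothesis forces $i=0$, and the factor $(\omega/(4\|A\|))^{2i}$ is read as $1$.) -/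

import Mathlib

open MeasureTheory

/-- `lam : Fin n → ℝ` lists `n` real numbers, counted with multiplicity.  They are
`(δ, ω, j)`-equidistributed if for every finite set `T` of at most `j` real numbers, at least `δ n`
of them satisfy `(1 / |T|) ∑ t ∈ T, log |lam k - t| ≥ log ω`, where `log 0 = -∞`.
As `Real.log 0 = 0`, the convention `log 0 = -∞` is spelled out as `lam k ∉ T`.  The inequality is
multiplied by `|T|`, so that every number satisfies it if `T` is empty. -/
def IsEquidistributed {n : ℕ} (lam : Fin n → ℝ) (δ ω : ℝ) (j : ℕ) : Prop :=
  ∀ T : Finset ℝ, T.card ≤ j →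
    δ * n ≤ (Set.ncard {k : Fin n | lam k ∉ T ∧
      (T.card : ℝ) * Real.log ω ≤ ∑ t ∈ T, Real.log |lam k - t|} : ℝ)

/-- The spectral norm, i.e. the `ℓ² → ℓ²` operator norm, of a complex matrix. -/
noncomputable def matrixOpNorm {n : ℕ} (A : Matrix (Fin n) (Fin n) ℂ) : ℝ :=
  ‖Matrix.toEuclideanCLM (n := Fin n) (𝕜 := ℂ) A‖

/-- A real vector, viewed as a complex one. -/
noncomputable def complexify {n : ℕ} (u : EuclideanSpace ℝ (Fin n)) : EuclideanSpace ℂ (Fin n) :=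
  WithLp.toLp 2 fun k => ((u k : ℝ) : ℂ)

/-- The component of `A v` orthogonal to `W`. -/
noncomputable def lanczosResidual {n : ℕ} (A : Matrix (Fin n) (Fin n) ℂ)
    (v : EuclideanSpace ℂ (Fin n)) (W : Submodule ℂ (EuclideanSpace ℂ (Fin n))) :
    EuclideanSpace ℂ (Fin n) :=
  Wᗮ.starProjection (Matrix.toEuclideanCLM (n := Fin n) (𝕜 := ℂ) A v)

/-- The pair `(v_j, W_j)`, `W_j = span {v_0, …, v_j}`, of the Lanczos algorithm run on `A` from the
start vector `v_0 = u`: `v_{j+1}` is the normalized component of `A v_j` orthogonal to `W_j`.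
The algorithm stops at the first `j` at which this component is zero; from there on the recursion
yields `v_{j+1} = 0` as a dummy value. -/
noncomputable def lanczosState {n : ℕ} (A : Matrix (Fin n) (Fin n) ℂ)
    (u : EuclideanSpace ℂ (Fin n)) :
    ℕ → EuclideanSpace ℂ (Fin n) × Submodule ℂ (EuclideanSpace ℂ (Fin n))
  | 0 => (u, Submodule.span ℂ {u})
  | j + 1 =>
    let v := (lanczosState A u j).1
    let W := (lanczosState A u j).2
    let w := lanczosResidual A v W
    let v' := ((‖w‖⁻¹ : ℝ) : ℂ) • w
    (v', W ⊔ Submodule.span ℂ {v'})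

/-- The Jacobi coefficient `α_j(u) = ⟨A v_j, v_j⟩`, which is real when `A` is Hermitian. -/
noncomputable def jacobiAlpha {n : ℕ} (A : Matrix (Fin n) (Fin n) ℂ) (j : ℕ)
    (u : EuclideanSpace ℂ (Fin n)) : ℝ :=
  (inner ℂ (lanczosState A u j).1
    (Matrix.toEuclideanCLM (n := Fin n) (𝕜 := ℂ) A (lanczosState A u j).1)).re

/-- The Jacobi coefficient `β_j(u)`: the norm of the component of `A v_j` orthogonal to `W_j`. -/
noncomputable def jacobiBeta {n : ℕ} (A : Matrix (Fin n) (Fin n) ℂ) (j : ℕ)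
    (u : EuclideanSpace ℂ (Fin n)) : ℝ :=
  ‖lanczosResidual A (lanczosState A u j).1 (lanczosState A u j).2‖

/-- The unit sphere of `ℝⁿ`. -/
abbrev UnitSphere (n : ℕ) : Type :=
  Metric.sphere (0 : EuclideanSpace ℝ (Fin n)) 1

/-- The uniform probability measure on the unit sphere of `ℝⁿ`: normalized surface measure. -/
noncomputable def sphereUniform (n : ℕ) : Measure (UnitSphere n) :=
  ((volume : Measure (EuclideanSpace ℝ (Fin n))).toSphere Set.univ)⁻¹ •
    (volume : Measure (EuclideanSpace ℝ (Fin n))).toSphere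

/-- `m` is a median of the random variable `X` under the probability measure `P`. -/
def IsMedian {Ω : Type*} [MeasurableSpace Ω] (P : Measure Ω) (X : Ω → ℝ) (m : ℝ) : Prop :=
  1 / 2 ≤ P.real {x | X x ≤ m} ∧ 1 / 2 ≤ P.real {x | m ≤ X x}

open scoped ENNReal Pointwise

/-! Let `r_j(u)` (`krylovResidual`) be the component of `A ^ j u` orthogonal to `u, …, A ^ (j - 1)
u`. Then `v_j = r_j / ‖r_j‖` and `β_j = ‖r_{j+1}‖ / ‖r_j‖` (`lanczosState_eq`, `jacobiBeta_eq`), so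
`α_i` and `β_i` are Lipschitz wherever `‖r_i‖` is bounded below. It remains to show that `r_i` is
Lipschitz, that `‖r_i‖` is rarely small, and that functions Lipschitz on most of the sphere
concentrate.

Lipschitz bound: `r_j(u) = p(A) u` for a monic `p` whose roots (Ritz values) are real and at most
`‖A‖` in absolute value. If also `r_j(w) = q(A) w`, orthogonality gives `‖r_j(u) - r_j(w)‖² = Re
⟨p(A)(u - w), q(A)(u - w)⟩`, whence the constant `(2‖A‖) ^ j` (`norm_krylovResidual_sub_le`).

Lower bound: `‖p(A) u‖²` is the sum of `p(λ_k)² |⟨e_k, u⟩|²`. Equidistribution makes `|p(λ_k)| ≥ ω ^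
i` on at least `δ n` indices, and a random `u` has mean mass at least `δ` on any fixed set of that
size. Since `p` depends on `u`, its roots are first rounded to a set of `2 n²` points at a cost of
`5 / 4` per root (`exists_roundingPoint`); a union bound over tuples then applies
(`sphereUniform_real_compl_spreadVectors_le`).

Concentration: the Prékopa–Leindler inequality, applied to cones over two sets at distance `ρ`,
bounds the product of their measures by `exp (-n ρ² / 4)` (`sphereUniform_real_mul_le`). This serves
both the mass estimate and the final deviation from the median
(`sphereUniform_real_lt_abs_sub_median_le`). -/

/-! ### Brunn–Minkowski and Prékopa–Leindler inequalities for midpoints. -/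

theorem volume_add_le_of_midpoint_mem_of_isCompact {K L C : Set ℝ} (hK : IsCompact K)
    (hL : IsCompact L) (hKne : K.Nonempty) (hLne : L.Nonempty)
    (h : ∀ a ∈ K, ∀ b ∈ L, (a + b) / 2 ∈ C) : volume K + volume L ≤ 2 * volume C := by
  obtain ⟨s, hsK, hs⟩ := hK.exists_isGreatest hKne
  obtain ⟨t, htL, ht⟩ := hL.exists_isLeast hLne
  have key : ∀ (S : Set ℝ) (c : ℝ), volume ((fun y => 2 * y) ⁻¹' ((fun y => y - c) ⁻¹' S)) =
      2⁻¹ * volume S := by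
    intro S c
    simp only [sub_eq_add_neg]
    rw [Real.volume_preimage_mul_left (by norm_num), measure_preimage_add_right]
    congr 1
    rw [abs_of_pos (by norm_num), ENNReal.ofReal_inv_of_pos (by norm_num)]
    norm_num
  -- `U = (K + min L) / 2` and `V = (max K + L) / 2` consist of midpoints and meet at most in `(max
  -- K + min L) / 2`.
  set U := (fun y : ℝ => 2 * y) ⁻¹' ((fun y => y - t) ⁻¹' K) with hU
  set V := (fun y : ℝ => 2 * y) ⁻¹' ((fun y => y - s) ⁻¹' L) with hV
  have hVm : MeasurableSet V :=
    (measurable_const_mul (2 : ℝ)) ((measurable_sub_const s) hL.measurableSet)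
  have hsub : U ∪ V ⊆ C := by
    rintro y (hy | hy)
    · have := h _ hy t htL
      simpa using this
    · have := h s hsK _ hy
      simpa using this
  have hdisj : AEDisjoint volume U V := by
    refine measure_mono_null (t := {(s + t) / 2}) ?_ (by simp)
    rintro y ⟨hyU, hyV⟩
    have h1 := hs hyU
    have h2 := ht hyV
    simp only [Set.mem_singleton_iff]
    dsimp only at h1 h2
    linarith
  have h3 : volume U + volume V ≤ volume C := by
    rw [← measure_union₀ hVm.nullMeasurableSet hdisj]
    exact measure_mono hsub
  rw [hU, hV, key, key, ← mul_add] at h3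
  calc volume K + volume L = 2 * (2⁻¹ * (volume K + volume L)) := by
        rw [← mul_assoc, ENNReal.mul_inv_cancel (by norm_num) (by norm_num), one_mul]
    _ ≤ _ := by gcongr

/-- The Brunn–Minkowski inequality on the line, for midpoints. -/
theorem volume_add_le_of_midpoint_mem {A B C : Set ℝ} (hA : MeasurableSet A)
    (hB : MeasurableSet B) (hAne : A.Nonempty) (hBne : B.Nonempty)
    (h : ∀ a ∈ A, ∀ b ∈ B, (a + b) / 2 ∈ C) : volume A + volume B ≤ 2 * volume C := by
  obtain ⟨a, ha⟩ := hAne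
  obtain ⟨b, hb⟩ := hBne
  rw [hA.measure_eq_iSup_isCompact, hB.measure_eq_iSup_isCompact]
  simp only [iSup_and']
  refine ENNReal.biSup_add_biSup_le' ⟨∅, by simp⟩ ⟨∅, by simp⟩ ?_
  rintro K ⟨hKA, hK⟩ L ⟨hLB, hL⟩
  have := volume_add_le_of_midpoint_mem_of_isCompact (hK.insert a) (hL.insert b)
    (Set.insert_nonempty _ _) (Set.insert_nonempty _ _) (C := C) ?_
  · refine le_trans (add_le_add ?_ ?_) this <;> exact measure_mono (Set.subset_insert _ _)
  · intro x hx y hy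
    exact h x (Set.insert_subset ha hKA hx) y (Set.insert_subset hb hLB hy)

theorem lintegral_eq_lintegral_volume_lt {f : ℝ → ℝ≥0∞} (hf : Measurable f)
    (hfin : ∀ x, f x ≠ ∞) :
    ∫⁻ x, f x = ∫⁻ t in Set.Ioi (0 : ℝ), volume {x | ENNReal.ofReal t < f x} := by
  have h := lintegral_eq_lintegral_meas_lt (volume : Measure ℝ) (f := fun x => (f x).toReal)
    (Filter.Eventually.of_forall fun x => ENNReal.toReal_nonneg) hf.ennreal_toReal.aemeasurable
  simp only [ENNReal.ofReal_toReal (hfin _)] at h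
  rw [h]
  refine setLIntegral_congr_fun measurableSet_Ioi fun t ht => ?_
  congr 1
  ext x
  exact (ENNReal.ofReal_lt_iff_lt_toReal (le_of_lt ht) (hfin x)).symm

/-- Layer cake: for `t < 1` the superlevel sets of `f` and `g` are nonempty and their midpoints lie
in that of `h`, so one-dimensional Brunn–Minkowski applies at every level. Nonemptiness is the
reason for normalizing the suprema to one. -/
theorem lintegral_add_le_of_sup_eq_one {f g h : ℝ → ℝ≥0∞} (hf : Measurable f) (hg : Measurable g)
    (hh : Measurable h) (hf1 : ∀ x, f x ≤ 1) (hg1 : ∀ x, g x ≤ 1)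
    (hfs : ∀ t < 1, ∃ x, t < f x) (hgs : ∀ t < 1, ∃ x, t < g x)
    (hfg : ∀ x y, f x * g y ≤ h ((x + y) / 2) ^ 2) :
    (∫⁻ x, f x) + ∫⁻ x, g x ≤ 2 * ∫⁻ x, h x := by
  -- Capping `h` at one makes it finite, as the layer-cake formula requires, and loses nothing
  -- because only levels below one matter.
  have hmin : ∫⁻ x, min (h x) 1 ≤ ∫⁻ x, h x := lintegral_mono fun x => min_le_left _ _
  refine le_trans ?_ (mul_le_mul_right hmin 2)
  rw [lintegral_eq_lintegral_volume_lt hf fun x => ((hf1 x).trans_lt ENNReal.one_lt_top).ne,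
    lintegral_eq_lintegral_volume_lt hg fun x => ((hg1 x).trans_lt ENNReal.one_lt_top).ne,
    lintegral_eq_lintegral_volume_lt (hh.min measurable_const)
      fun x => ((min_le_right _ _).trans_lt ENNReal.one_lt_top).ne]
  have hanti : ∀ k : ℝ → ℝ≥0∞, Measurable fun t : ℝ => volume {x | ENNReal.ofReal t < k x} := by
    intro k
    refine Antitone.measurable fun s t hst => measure_mono fun x hx => ?_
    exact (ENNReal.ofReal_le_ofReal hst).trans_lt hx
  rw [← lintegral_add_left (hanti f), ← lintegral_const_mul _ (hanti _)]
  refine lintegral_mono fun t => ?_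
  by_cases ht : ENNReal.ofReal t < 1
  · refine volume_add_le_of_midpoint_mem (measurableSet_lt measurable_const hf)
      (measurableSet_lt measurable_const hg) (hfs _ ht) (hgs _ ht) ?_
    intro a ha b hb
    refine lt_min ?_ ht
    have h1 : ENNReal.ofReal t * ENNReal.ofReal t < f a * g b := ENNReal.mul_lt_mul ha hb
    have h2 := h1.trans_le (hfg a b)
    by_contra hcon
    rw [not_lt] at hcon
    refine absurd h2 (not_lt.2 ?_)
    rw [← sq]
    gcongr
  · have e1 : ∀ k : ℝ → ℝ≥0∞, (∀ x, k x ≤ 1) → {x | ENNReal.ofReal t < k x} = ∅ := by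
      intro k hk
      ext x
      simp only [Set.mem_ofPred_eq, Set.mem_empty_iff_false, iff_false, not_lt]
      exact (hk x).trans (not_lt.1 ht)
    rw [e1 f hf1, e1 g hg1]
    simp

theorem ENNReal.mul_le_sq_of_add_le_two_mul {a b c : ℝ≥0∞} (h : a + b ≤ 2 * c) :
    a * b ≤ c ^ 2 := by
  rcases eq_or_ne c ∞ with rfl | hc
  · simp
  have h2 : a + b ≠ ∞ := (h.trans_lt (ENNReal.mul_lt_top (by simp) hc.lt_top)).ne
  obtain ⟨ha, hb⟩ := ENNReal.add_ne_top.1 h2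
  lift a to NNReal using ha
  lift b to NNReal using hb
  lift c to NNReal using hc
  have h' : a + b ≤ 2 * c := by exact_mod_cast h
  have : a * b ≤ c ^ 2 := by
    have h'' : (a : ℝ) + b ≤ 2 * c := by exact_mod_cast h'
    have : (a : ℝ) * b ≤ c ^ 2 := by
      nlinarith [sq_nonneg ((a : ℝ) - b), a.2, b.2, c.2, NNReal.coe_nonneg a,
        NNReal.coe_nonneg b, NNReal.coe_nonneg c]
    exact_mod_cast this
  exact_mod_cast this

/-- Divide `f` and `g` by their suprema `a`, `b` and `h` by `√(a b)`. The additive inequality for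
the normalized functions yields the multiplicative one by AM–GM. -/
theorem lintegral_mul_le_sq_of_bounded {f g h : ℝ → ℝ≥0∞} (hf : Measurable f) (hg : Measurable g)
    (hh : Measurable h) {k : ℝ≥0∞} (hk : k ≠ ∞) (hf1 : ∀ x, f x ≤ k) (hg1 : ∀ x, g x ≤ k)
    (hfg : ∀ x y, f x * g y ≤ h ((x + y) / 2) ^ 2) :
    (∫⁻ x, f x) * ∫⁻ x, g x ≤ (∫⁻ x, h x) ^ 2 := by
  set a := ⨆ x, f x with ha
  set b := ⨆ x, g x with hb
  have hat : a ≠ ∞ := ((iSup_le hf1).trans_lt hk.lt_top).ne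
  have hbt : b ≠ ∞ := ((iSup_le hg1).trans_lt hk.lt_top).ne
  rcases eq_or_ne a 0 with ha0 | ha0
  · have : ∀ x, f x = 0 := fun x => by
      have := le_iSup f x
      rw [← ha, ha0] at this
      simpa using this
    simp [this]
  rcases eq_or_ne b 0 with hb0 | hb0
  · have : ∀ x, g x = 0 := fun x => by
      have := le_iSup g x
      rw [← hb, hb0] at this
      simpa using this
    simp [this]
  set c := (a * b) ^ (1 / 2 : ℝ) with hc
  have hc2 : c ^ 2 = a * b := by
    rw [hc, ← ENNReal.rpow_natCast, ← ENNReal.rpow_mul]; norm_num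
  have hsup : ∀ (k : ℝ → ℝ≥0∞), (⨆ x, k x) ≠ 0 → (⨆ x, k x) ≠ ∞ → ∀ t < 1, ∃ x,
      t < k x * (⨆ x, k x)⁻¹ := by
    intro k hk0 hkt t ht
    have : t * (⨆ x, k x) < ⨆ x, k x := by
      conv_rhs => rw [← one_mul (⨆ x, k x)]
      exact ENNReal.mul_lt_mul_left hk0 hkt ht
    obtain ⟨x, hx⟩ := lt_iSup_iff.1 this
    refine ⟨x, ?_⟩
    rw [← div_eq_mul_inv]
    exact (ENNReal.lt_div_iff_mul_lt (Or.inl hk0) (Or.inl hkt)).2 hx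
  have hle : ∀ (k : ℝ → ℝ≥0∞) x, k x * (⨆ x, k x)⁻¹ ≤ 1 := by
    intro k x
    rw [← div_eq_mul_inv]
    exact ENNReal.div_le_of_le_mul (by rw [one_mul]; exact le_iSup k x)
  have hmain := lintegral_add_le_of_sup_eq_one (f := fun x => f x * a⁻¹)
    (g := fun x => g x * b⁻¹) (h := fun x => h x * c⁻¹) (hf.mul_const _) (hg.mul_const _)
    (hh.mul_const _) (hle f) (hle g) (hsup f ha0 hat) (hsup g hb0 hbt) (by
      intro x y
      rw [mul_pow, ← ENNReal.inv_pow, hc2, ENNReal.mul_inv (Or.inl ha0) (Or.inl hat)]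
      calc f x * a⁻¹ * (g y * b⁻¹) = (f x * g y) * (a⁻¹ * b⁻¹) := by ring
        _ ≤ _ := mul_le_mul_left (hfg x y) _)
  have := ENNReal.mul_le_sq_of_add_le_two_mul hmain
  rw [lintegral_mul_const _ hf, lintegral_mul_const _ hg, lintegral_mul_const _ hh, mul_pow,
    ← ENNReal.inv_pow, hc2] at this
  have h3 : (∫⁻ x, f x) * ∫⁻ x, g x
      = ((∫⁻ x, f x) * a⁻¹ * ((∫⁻ x, g x) * b⁻¹)) * (a * b) := by
    calc _ = (∫⁻ x, f x) * (∫⁻ x, g x) * ((a⁻¹ * a) * (b⁻¹ * b)) := by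
          rw [ENNReal.inv_mul_cancel ha0 hat, ENNReal.inv_mul_cancel hb0 hbt]; simp
      _ = _ := by ring
  rw [h3]
  calc _ ≤ (∫⁻ x, h x) ^ 2 * (a * b)⁻¹ * (a * b) := mul_le_mul_left this _
    _ = _ := by
      rw [mul_assoc, ENNReal.inv_mul_cancel (mul_ne_zero ha0 hb0) (ENNReal.mul_ne_top hat hbt),
        mul_one]

/-- The Prékopa–Leindler inequality on the line, for midpoints. -/
theorem lintegral_mul_le_sq {f g h : ℝ → ℝ≥0∞} (hf : Measurable f) (hg : Measurable g)
    (hh : Measurable h) (hfg : ∀ x y, f x * g y ≤ h ((x + y) / 2) ^ 2) :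
    (∫⁻ x, f x) * ∫⁻ x, g x ≤ (∫⁻ x, h x) ^ 2 := by
  have htr : ∀ k : ℝ → ℝ≥0∞, Measurable k →
      ∫⁻ x, k x = ⨆ m : ℕ, ∫⁻ x, min (k x) (m : ℝ≥0∞) := by
    intro k hk
    rw [← lintegral_iSup (fun m => hk.min measurable_const)]
    · refine lintegral_congr fun x => ?_
      have h1 : (⨆ m : ℕ, min (k x) (m : ℝ≥0∞)) = min (k x) (⨆ m : ℕ, (m : ℝ≥0∞)) :=
        (inf_iSup_eq _ _).symm
      rw [h1, ENNReal.iSup_natCast]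
      simp
    · intro m m' hmm x
      exact min_le_min le_rfl (by exact_mod_cast hmm)
  have hmono : ∀ k : ℝ → ℝ≥0∞, Monotone fun m : ℕ => ∫⁻ x, min (k x) (m : ℝ≥0∞) :=
    fun k m m' hmm => lintegral_mono fun x => min_le_min le_rfl (by exact_mod_cast hmm)
  rw [htr f hf, htr g hg, ENNReal.iSup_mul]
  refine iSup_le fun m => ?_
  rw [ENNReal.mul_iSup]
  refine iSup_le fun m' => ?_
  refine le_trans (mul_le_mul' (hmono f (le_max_left m m')) (hmono g (le_max_right m m'))) ?_
  refine lintegral_mul_le_sq_of_bounded (hf.min measurable_const) (hg.min measurable_const) hh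
    (ENNReal.natCast_ne_top (max m m')) (fun x => min_le_right _ _) (fun x => min_le_right _ _) ?_
  intro x y
  exact (mul_le_mul' (min_le_left _ _) (min_le_left _ _)).trans (hfg x y)

theorem lintegral_fin_succ {n : ℕ} {f : (Fin (n + 1) → ℝ) → ℝ≥0∞} (hf : Measurable f) :
    ∫⁻ x, f x = ∫⁻ s : ℝ, ∫⁻ y : Fin n → ℝ, f (Fin.cons s y) := by
  have hmp := (volume_preserving_piFinSuccAbove (fun _ : Fin (n + 1) => ℝ) 0).symm
  rw [← hmp.lintegral_comp hf, Measure.volume_eq_prod, lintegral_prod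
    (fun a => f ((MeasurableEquiv.piFinSuccAbove (fun _ => ℝ) 0).symm a))
    (hf.comp hmp.measurable).aemeasurable]
  simp [MeasurableEquiv.piFinSuccAbove, Fin.insertNthEquiv]

/-- The Prékopa–Leindler inequality, for midpoints. -/
theorem lintegral_pi_mul_le_sq {n : ℕ} {f g h : (Fin n → ℝ) → ℝ≥0∞} (hf : Measurable f)
    (hg : Measurable g) (hh : Measurable h)
    (hfg : ∀ x y, f x * g y ≤ h (fun k => (x k + y k) / 2) ^ 2) :
    (∫⁻ x, f x) * ∫⁻ x, g x ≤ (∫⁻ x, h x) ^ 2 := by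
  induction n with
  | zero =>
    have : (volume : Measure (Fin 0 → ℝ)) Set.univ = 1 := by
      rw [volume_pi, Measure.pi_univ]
      simp
    rw [lintegral_unique, lintegral_unique, lintegral_unique, this]
    simp only [mul_one]
    convert hfg default default
  | succ n ih =>
    have hcons : Measurable fun z : ℝ × (Fin n → ℝ) => (Fin.cons z.1 z.2 : Fin (n + 1) → ℝ) := by
      refine measurable_pi_iff.2 fun k => ?_
      refine Fin.cases ?_ (fun k => ?_) k
      · simpa using measurable_fst
      · simp only [Fin.cons_succ]
        fun_prop
    have hm : ∀ k : (Fin (n + 1) → ℝ) → ℝ≥0∞, Measurable k →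
        Measurable fun s : ℝ => ∫⁻ y : Fin n → ℝ, k (Fin.cons s y) :=
      fun k hk => Measurable.lintegral_prod_right' (f := fun z : ℝ × (Fin n → ℝ) =>
        k (Fin.cons z.1 z.2)) (hk.comp hcons)
    have hm' : ∀ k : (Fin (n + 1) → ℝ) → ℝ≥0∞, Measurable k → ∀ s : ℝ,
        Measurable fun y : Fin n → ℝ => k (Fin.cons s y) :=
      fun k hk s => (hk.comp hcons).comp measurable_prodMk_left
    rw [lintegral_fin_succ hf, lintegral_fin_succ hg, lintegral_fin_succ hh]
    refine lintegral_mul_le_sq (hm f hf) (hm g hg) (hm h hh) fun s t => ?_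
    refine ih (hm' f hf s) (hm' g hg t) (hm' h hh _) fun x y => ?_
    convert hfg (Fin.cons s x) (Fin.cons t y) using 3
    funext k
    refine Fin.cases ?_ (fun k => ?_) k <;> simp

/-! ### Concentration of measure on the sphere. -/

theorem volume_mul_le_of_norm_midpoint_le {n : ℕ} {X Y : Set (EuclideanSpace ℝ (Fin n))}
    (hX : MeasurableSet X) (hY : MeasurableSet Y) {R : ℝ}
    (h : ∀ x ∈ X, ∀ y ∈ Y, ‖(1 / 2 : ℝ) • (x + y)‖ ≤ R) :
    volume X * volume Y ≤ volume (Metric.closedBall (0 : EuclideanSpace ℝ (Fin n)) R) ^ 2 := by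
  have hmp := (EuclideanSpace.volume_preserving_symm_measurableEquiv_toLp (Fin n)).symm
  set e := (MeasurableEquiv.toLp 2 (Fin n → ℝ))
  have hint : ∀ S : Set (EuclideanSpace ℝ (Fin n)), MeasurableSet S →
      volume S = ∫⁻ x : Fin n → ℝ, S.indicator (fun _ => (1 : ℝ≥0∞)) (WithLp.toLp 2 x) := by
    intro S hS
    rw [← lintegral_indicator_one hS]
    exact (hmp.lintegral_comp (f := S.indicator fun _ => (1 : ℝ≥0∞))
      (measurable_const.indicator hS)).symm
  have hme : ∀ S : Set (EuclideanSpace ℝ (Fin n)), MeasurableSet S →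
      Measurable fun x : Fin n → ℝ => S.indicator (fun _ => (1 : ℝ≥0∞)) (WithLp.toLp 2 x) := by
    intro S hS
    exact (measurable_const.indicator hS).comp e.measurable
  have hb := (Metric.isClosed_closedBall (x := (0 : EuclideanSpace ℝ (Fin n))) (ε := R)).measurableSet
  rw [hint X hX, hint Y hY, hint _ hb]
  refine lintegral_pi_mul_le_sq (hme X hX) (hme Y hY) (hme _ hb) fun x y => ?_
  by_cases hx : WithLp.toLp 2 x ∈ X
  · by_cases hy : WithLp.toLp 2 y ∈ Y
    · have : WithLp.toLp 2 (fun k => (x k + y k) / 2) ∈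
          Metric.closedBall (0 : EuclideanSpace ℝ (Fin n)) R := by
        have h1 := h _ hx _ hy
        rw [mem_closedBall_zero_iff]
        refine le_of_eq_of_le (congrArg norm ?_) h1
        ext k
        simp
        ring
      simp [hx, hy, this]
    · simp [hy]
  · simp [hx]

/-- With `c = ⟨a, b⟩`, write `r² + s² + 2rsc = (r² + s² - rs) + rs(1 + 2c)`, where the first bracket
is at most one. If `c ≥ -1/2`, the squared norm is at most `(1 + c) / 2 ≤ 1 - ρ² / 4`. Otherwise it
is at most `1/4 < e⁻¹`, which suffices because `ρ ≤ 2`. -/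
theorem norm_midpoint_smul_le {n : ℕ} {a b : EuclideanSpace ℝ (Fin n)} (ha : ‖a‖ = 1)
    (hb : ‖b‖ = 1) {r s ρ : ℝ} (hr : r ∈ Set.Ioo (0 : ℝ) 1) (hs : s ∈ Set.Ioo (0 : ℝ) 1)
    (hρ : 0 ≤ ρ) (hab : ρ ≤ ‖a - b‖) :
    ‖(1 / 2 : ℝ) • (r • a + s • b)‖ ^ 2 ≤ Real.exp (-(ρ ^ 2 / 4)) := by
  obtain ⟨hr0, hr1⟩ := hr
  obtain ⟨hs0, hs1⟩ := hs
  set c := inner ℝ a b with hc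
  have h1 : ‖(1 / 2 : ℝ) • (r • a + s • b)‖ ^ 2 = (r ^ 2 + s ^ 2 + 2 * (r * s) * c) / 4 := by
    rw [norm_smul, mul_pow, @norm_add_sq_real, norm_smul, norm_smul, ha, hb, inner_smul_left,
      inner_smul_right]
    simp only [Real.norm_eq_abs, mul_one, sq_abs, conj_trivial]
    ring
  have h2 : ρ ^ 2 ≤ 2 - 2 * c := by
    have : ρ ^ 2 ≤ ‖a - b‖ ^ 2 := by gcongr
    rw [@norm_sub_sq_real, ha, hb] at this
    linarith
  have hc1 : -1 ≤ c := by
    have := abs_le.1 (abs_real_inner_le_norm a b)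
    rw [ha, hb] at this
    linarith [this.1]
  have hq : r ^ 2 + s ^ 2 - r * s ≤ 1 := by
    rcases le_total r s with h | h
    · nlinarith
    · nlinarith
  have hrs : r * s ≤ 1 := by nlinarith
  have hrs0 : 0 < r * s := by positivity
  rw [h1]
  rcases le_total (-1 / 2) c with hcc | hcc
  · have h3 : r ^ 2 + s ^ 2 + 2 * (r * s) * c ≤ 2 + 2 * c := by
      nlinarith [mul_nonneg (sub_nonneg.2 hcc) (sub_nonneg.2 hrs)]
    have h4 := Real.add_one_le_exp (-(ρ ^ 2 / 4))
    linarith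
  · have h3 : r ^ 2 + s ^ 2 + 2 * (r * s) * c ≤ 1 := by nlinarith
    have h4 : Real.exp (-1) ≤ Real.exp (-(ρ ^ 2 / 4)) := Real.exp_le_exp.2 (by linarith)
    have h5 : (1 : ℝ) / 4 ≤ Real.exp (-1) := by
      rw [Real.exp_neg, one_div]
      exact inv_anti₀ (Real.exp_pos 1) (by linarith [Real.exp_one_lt_d9])
    linarith

/-- The open cone spanned by a subset of the unit sphere, without its apex. -/
abbrev unitCone {n : ℕ} (s : Set (UnitSphere n)) : Set (EuclideanSpace ℝ (Fin n)) :=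
  Set.Ioo (0 : ℝ) 1 • (Subtype.val '' s)

theorem measurableSet_unitCone {n : ℕ} {s : Set (UnitSphere n)} (hs : MeasurableSet s) :
    MeasurableSet (unitCone s) := by
  have : unitCone s = Subtype.val '' (homeomorphUnitSphereProd (EuclideanSpace ℝ (Fin n)) ⁻¹'
      (s ×ˢ Set.Iio (⟨1, Set.mem_Ioi.2 one_pos⟩ : Set.Ioi (0 : ℝ)))) := by
    rw [unitCone, ← Set.image2_smul, Set.image2_image_right, ← Homeomorph.image_symm,
      Set.image_image, ← Set.image_subtype_val_Ioi_Iio ⟨1, Set.mem_Ioi.2 one_pos⟩, Set.image2_image_left,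
      Set.image2_swap, ← Set.image_prod]
    rfl
  rw [this]
  refine (MeasurableEmbedding.subtype_coe (measurableSet_singleton _).compl).measurableSet_image.2 ?_
  exact (Homeomorph.measurable _) (hs.prod measurableSet_Iio)

theorem sphereUniform_apply {n : ℕ} (hn : n ≠ 0) {s : Set (UnitSphere n)} (hs : MeasurableSet s) :
    sphereUniform n s = volume (unitCone s) /
      volume (Metric.ball (0 : EuclideanSpace ℝ (Fin n)) 1) := by
  have hn' : ((Module.finrank ℝ (EuclideanSpace ℝ (Fin n)) : ℕ) : ℝ≥0∞) ≠ 0 := by simpa using hn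
  rw [sphereUniform, Measure.smul_apply, Measure.toSphere_apply' _ hs,
    Measure.toSphere_apply_univ, smul_eq_mul, mul_comm, ← div_eq_mul_inv,
    ENNReal.mul_div_mul_left _ _ hn' (ENNReal.natCast_ne_top _)]

theorem isProbabilityMeasure_sphereUniform {n : ℕ} (hn : n ≠ 0) :
    IsProbabilityMeasure (sphereUniform n) := by
  constructor
  have : Nonempty (Fin n) := Fin.pos_iff_nonempty.1 (Nat.pos_of_ne_zero hn)
  rw [sphereUniform, Measure.smul_apply, smul_eq_mul]
  refine ENNReal.inv_mul_cancel ?_ (measure_ne_top _ _)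
  exact Measure.measure_univ_ne_zero.2 (Measure.toSphere_ne_zero _)

theorem sphereUniform_zero : sphereUniform 0 = 0 := by
  have : (volume : Measure (EuclideanSpace ℝ (Fin 0))).toSphere = 0 :=
    (Measure.toSphere_eq_zero_iff _).2 inferInstance
  rw [sphereUniform, this, smul_zero]

theorem sphereUniform_mul_le_of_measurable {n : ℕ} (hn : n ≠ 0) {s t : Set (UnitSphere n)}
    (hs : MeasurableSet s) (ht : MeasurableSet t) {ρ : ℝ} (hρ : 0 ≤ ρ)
    (h : ∀ a ∈ s, ∀ b ∈ t, ρ ≤ dist a b) :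
    sphereUniform n s * sphereUniform n t ≤ ENNReal.ofReal (Real.exp (-(n * ρ ^ 2 / 4))) := by
  have : Nonempty (Fin n) := Fin.pos_iff_nonempty.1 (Nat.pos_of_ne_zero hn)
  set R := Real.exp (-(ρ ^ 2 / 8)) with hR
  have hR2 : R ^ 2 = Real.exp (-(ρ ^ 2 / 4)) := by
    rw [hR, ← Real.exp_nat_mul]; congr 1; push_cast; ring
  have hkey := volume_mul_le_of_norm_midpoint_le (measurableSet_unitCone hs)
    (measurableSet_unitCone ht) (R := R) (by
      rintro _ ⟨r, hr, _, ⟨a, ha, rfl⟩, rfl⟩ _ ⟨r', hr', _, ⟨b, hb, rfl⟩, rfl⟩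
      refine (sq_le_sq₀ (norm_nonneg _) (Real.exp_pos _).le).1 ?_
      rw [hR2]
      refine norm_midpoint_smul_le (by simp) (by simp) hr hr' hρ ?_
      have := h a ha b hb
      rwa [Subtype.dist_eq, dist_eq_norm] at this)
  rw [sphereUniform_apply hn hs, sphereUniform_apply hn ht]
  set V := volume (Metric.ball (0 : EuclideanSpace ℝ (Fin n)) 1) with hV
  have hV0 : V ≠ 0 := (Metric.measure_ball_pos _ _ one_pos).ne'
  have hVt : V ≠ ∞ := measure_ball_lt_top.ne
  rw [Measure.addHaar_closedBall _ _ (Real.exp_pos _).le, ← hV] at hkey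
  calc volume (unitCone s) / V * (volume (unitCone t) / V)
      = (volume (unitCone s) * volume (unitCone t)) * (V⁻¹ * V⁻¹) := by
        simp only [div_eq_mul_inv]; ring
    _ ≤ (ENNReal.ofReal (R ^ Module.finrank ℝ (EuclideanSpace ℝ (Fin n))) * V) ^ 2
          * (V⁻¹ * V⁻¹) := mul_le_mul_left hkey _
    _ = ENNReal.ofReal (R ^ n) ^ 2 * ((V * V⁻¹) * (V * V⁻¹)) := by
        rw [finrank_euclideanSpace_fin]; ring
    _ = _ := by
        rw [ENNReal.mul_inv_cancel hV0 hVt, mul_one, mul_one, ← ENNReal.ofReal_pow (by positivity)]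
        congr 1
        rw [← pow_mul, mul_comm n 2, pow_mul, hR2, ← Real.exp_nat_mul]
        congr 1
        ring

/-- Concentration of measure on the sphere: two sets at distance `ρ` cannot both be large. -/
theorem sphereUniform_real_mul_le {n : ℕ} (hn : n ≠ 0) {s t : Set (UnitSphere n)} {ρ : ℝ}
    (hρ : 0 ≤ ρ) (h : ∀ a ∈ s, ∀ b ∈ t, ρ ≤ dist a b) :
    (sphereUniform n).real s * (sphereUniform n).real t ≤ Real.exp (-(n * ρ ^ 2 / 4)) := by
  have := isProbabilityMeasure_sphereUniform hn
  -- The distance bound passes to closures, which are measurable, so arbitrary sets are allowed and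
  -- no measurability of the Jacobi coefficients is needed later.
  have h1 : ∀ a ∈ s, ∀ b ∈ closure t, ρ ≤ dist a b := fun a ha =>
    closure_minimal (s := t) (t := {b | ρ ≤ dist a b}) (h a ha)
      (isClosed_le continuous_const (continuous_const.dist continuous_id))
  have h2 : ∀ a ∈ closure s, ∀ b ∈ closure t, ρ ≤ dist a b := fun a ha b hb =>
    closure_minimal (s := s) (t := {a | ρ ≤ dist a b}) (fun a ha => h1 a ha b hb)
      (isClosed_le continuous_const (continuous_id.dist continuous_const)) ha
  have h3 := sphereUniform_mul_le_of_measurable hn isClosed_closure.measurableSet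
    isClosed_closure.measurableSet hρ h2
  have h4 := ENNReal.toReal_mono ENNReal.ofReal_ne_top h3
  rw [ENNReal.toReal_mul, ENNReal.toReal_ofReal (Real.exp_pos _).le] at h4
  refine le_trans ?_ h4
  exact mul_le_mul (measureReal_mono subset_closure) (measureReal_mono subset_closure)
    measureReal_nonneg measureReal_nonneg

/-! ### Second moments and a lower-tail bound on the sphere. -/

/-- The action of a linear isometry on the unit sphere. -/
noncomputable def sphereMap {n : ℕ} (T : EuclideanSpace ℝ (Fin n) ≃ₗᵢ[ℝ] EuclideanSpace ℝ (Fin n))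
    (u : UnitSphere n) : UnitSphere n :=
  ⟨T u.1, by simp⟩

theorem measurePreserving_sphereMap {n : ℕ} (hn : n ≠ 0)
    (T : EuclideanSpace ℝ (Fin n) ≃ₗᵢ[ℝ] EuclideanSpace ℝ (Fin n)) :
    MeasurePreserving (sphereMap T) (sphereUniform n) (sphereUniform n) := by
  have hm : Measurable (sphereMap T) :=
    ((T.continuous.comp continuous_subtype_val).subtype_mk _).measurable
  refine ⟨hm, Measure.ext fun s hs => ?_⟩
  rw [Measure.map_apply hm hs, sphereUniform_apply hn hs, sphereUniform_apply hn (hm hs)]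
  congr 1
  rw [← T.measurePreserving.measure_preimage (measurableSet_unitCone hs).nullMeasurableSet]
  congr 1
  ext x
  constructor
  · rintro ⟨r, hr, _, ⟨a, ha, rfl⟩, rfl⟩
    exact ⟨r, hr, _, ⟨sphereMap T a, ha, rfl⟩, by simp [sphereMap]⟩
  · rintro ⟨r, hr, _, ⟨a, ha, rfl⟩, hx⟩
    refine ⟨r, hr, _, ⟨⟨T.symm a.1, by simp⟩, ?_, rfl⟩, ?_⟩
    · simpa [sphereMap] using ha
    · dsimp only at hx ⊢
      rw [← map_smul, hx, T.symm_apply_apply]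

theorem integrable_inner_sq {n : ℕ} (hn : n ≠ 0) (v : EuclideanSpace ℝ (Fin n)) :
    Integrable (fun u : UnitSphere n => inner ℝ v u.1 ^ 2) (sphereUniform n) := by
  have := isProbabilityMeasure_sphereUniform hn
  have hc : Continuous fun u : UnitSphere n => inner ℝ v u.1 ^ 2 := by fun_prop
  exact hc.integrable_of_hasCompactSupport (HasCompactSupport.of_compactSpace _)

/-- A reflection carries `v` to any vector of the same length, so by invariance all coordinates have
the same second moment; these sum to one. -/
theorem integral_inner_sq {n : ℕ} (hn : n ≠ 0) (v : EuclideanSpace ℝ (Fin n)) :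
    ∫ u : UnitSphere n, inner ℝ v u.1 ^ 2 ∂(sphereUniform n) = ‖v‖ ^ 2 / n := by
  have := isProbabilityMeasure_sphereUniform hn
  have hinv : ∀ w : EuclideanSpace ℝ (Fin n), ‖v‖ = ‖w‖ →
      ∫ u : UnitSphere n, inner ℝ v u.1 ^ 2 ∂(sphereUniform n) =
        ∫ u : UnitSphere n, inner ℝ w u.1 ^ 2 ∂(sphereUniform n) := by
    intro w hvw
    set T := (Submodule.span ℝ {v - w})ᗮ.reflection
    have hT : T v = w := Submodule.reflection_sub hvw
    have hmp := measurePreserving_sphereMap hn T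
    have hc : Continuous fun u : UnitSphere n => inner ℝ w u.1 ^ 2 := by fun_prop
    conv_rhs => rw [← hmp.map_eq]
    rw [integral_map hmp.aemeasurable hc.aestronglyMeasurable]
    refine integral_congr_ae (Filter.Eventually.of_forall fun u => ?_)
    simp only [sphereMap]
    rw [← hT, T.inner_map_map]
  have hk : ∀ k : Fin n, ∫ u : UnitSphere n, inner ℝ v u.1 ^ 2 ∂(sphereUniform n) =
      ∫ u : UnitSphere n, ‖v‖ ^ 2 * u.1 k ^ 2 ∂(sphereUniform n) := by
    intro k
    rw [hinv (EuclideanSpace.single k ‖v‖) (by simp)]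
    refine integral_congr_ae (Filter.Eventually.of_forall fun u => ?_)
    simp [EuclideanSpace.inner_single_left, mul_pow]
  have hint : ∀ k : Fin n,
      Integrable (fun u : UnitSphere n => ‖v‖ ^ 2 * u.1 k ^ 2) (sphereUniform n) := by
    intro k
    have hc : Continuous fun u : UnitSphere n => ‖v‖ ^ 2 * u.1 k ^ 2 := by fun_prop
    exact hc.integrable_of_hasCompactSupport (HasCompactSupport.of_compactSpace _)
  have hsum : ∑ _k : Fin n, ∫ u : UnitSphere n, inner ℝ v u.1 ^ 2 ∂(sphereUniform n) = ‖v‖ ^ 2 := by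
    rw [Finset.sum_congr rfl fun k _ => hk k, ← integral_finsetSum _ fun k _ => hint k]
    have : ∀ u : UnitSphere n, ∑ k, ‖v‖ ^ 2 * u.1 k ^ 2 = ‖v‖ ^ 2 := by
      intro u
      rw [← Finset.mul_sum, ← EuclideanSpace.real_norm_sq_eq]
      simp
    simp [this]
  rw [Finset.sum_const, Finset.card_univ, Fintype.card_fin, nsmul_eq_mul] at hsum
  rw [← hsum, mul_div_cancel_left₀ _ (by exact_mod_cast hn)]

theorem norm_inner_complexify_sq {n : ℕ} (e : EuclideanSpace ℂ (Fin n))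
    (u : EuclideanSpace ℝ (Fin n)) :
    ‖inner ℂ e (complexify u)‖ ^ 2 = inner ℝ (WithLp.toLp 2 fun k => (e k).re) u ^ 2 +
      inner ℝ (WithLp.toLp 2 fun k => (e k).im) u ^ 2 := by
  rw [← Complex.normSq_eq_norm_sq, Complex.normSq_apply]
  simp only [complexify, PiLp.inner_apply, RCLike.inner_apply, conj_trivial, Complex.re_sum,
    Complex.im_sum, Complex.re_ofReal_mul, Complex.im_ofReal_mul, Complex.conj_re, Complex.conj_im]
  simp only [mul_neg, Finset.sum_neg_distrib]
  ring

theorem integral_norm_inner_sq {n : ℕ} (hn : n ≠ 0) {e : EuclideanSpace ℂ (Fin n)}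
    (he : ‖e‖ = 1) :
    ∫ u : UnitSphere n, ‖inner ℂ e (complexify u.1)‖ ^ 2 ∂(sphereUniform n) = 1 / n := by
  simp only [norm_inner_complexify_sq]
  rw [integral_add (integrable_inner_sq hn _) (integrable_inner_sq hn _), integral_inner_sq hn,
    integral_inner_sq hn, ← add_div]
  congr 1
  rw [EuclideanSpace.real_norm_sq_eq, EuclideanSpace.real_norm_sq_eq, ← Finset.sum_add_distrib]
  have := EuclideanSpace.norm_sq_eq e
  rw [he, one_pow] at this
  rw [this]
  refine Finset.sum_congr rfl fun k _ => ?_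
  rw [← Complex.normSq_eq_norm_sq, Complex.normSq_apply]
  simp
  ring

/-- Lower-tail bound for a nonnegative `1`-Lipschitz function with second moment at least `δ`. -/
theorem sphereUniform_real_lt_le {n : ℕ} (hn : n ≠ 0) {G : UnitSphere n → ℝ}
    (hG : LipschitzWith 1 G) (hG0 : ∀ u, 0 ≤ G u) (hG1 : ∀ u, G u ≤ 1) {δ : ℝ} (hδ : 0 < δ)
    (hmom : δ ≤ ∫ u, G u ^ 2 ∂(sphereUniform n)) :
    (sphereUniform n).real {u | G u < 2 / 3 * √δ} ≤ 7 / δ * Real.exp (-(n * δ / 64)) := by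
  have := isProbabilityMeasure_sphereUniform hn
  set H := {u | 11 / 12 * √δ ≤ G u} with hH
  have hHm : MeasurableSet H := measurableSet_le measurable_const hG.continuous.measurable
  have hsq : √δ ^ 2 = δ := Real.sq_sqrt hδ.le
  -- As `G ≤ 1`, the second moment is at most `(11/12)² δ` plus the measure of `H`, which is
  -- therefore at least `23 δ / 144 ≥ δ / 7`. The levels `11/12` and `2/3` differ by `1/4`, so the
  -- Lipschitz bound separates the two sets by `√δ / 4`.
  have h1 : δ / 7 ≤ (sphereUniform n).real H := by
    have hle : ∫ u, G u ^ 2 ∂(sphereUniform n) ≤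
        ∫ u, (121 / 144 * δ + H.indicator (fun _ => (1 : ℝ)) u) ∂(sphereUniform n) := by
      refine integral_mono ?_ ?_ fun u => ?_
      · exact (hG.continuous.pow 2).integrable_of_hasCompactSupport
          (HasCompactSupport.of_compactSpace _)
      · exact (integrable_const _).add ((integrable_const (1 : ℝ)).indicator hHm)
      · by_cases hu : u ∈ H
        · simp only [Set.indicator_of_mem hu]
          nlinarith [hG0 u, hG1 u]
        · simp only [Set.indicator_of_notMem hu, add_zero]
          have : G u < 11 / 12 * √δ := not_le.1 hu
          nlinarith [hG0 u, Real.sqrt_nonneg δ]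
    rw [integral_add (integrable_const _) ((integrable_const (1 : ℝ)).indicator hHm),
      integral_indicator_const _ hHm] at hle
    simp only [integral_const, probReal_univ, smul_eq_mul, one_mul, mul_one] at hle
    linarith
  have h2 := sphereUniform_real_mul_le hn (s := H) (t := {u | G u < 2 / 3 * √δ}) (ρ := √δ / 4)
    (by positivity) (by
      intro a ha b hb
      have h3 : dist (G a) (G b) ≤ dist a b := by simpa using hG.dist_le_mul a b
      rw [Real.dist_eq] at h3
      have h4 := (le_abs_self _).trans h3
      have ha' : 11 / 12 * √δ ≤ G a := ha
      have hb' : G b < 2 / 3 * √δ := hb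
      linarith)
  have h3 : (n : ℝ) * (√δ / 4) ^ 2 / 4 = n * δ / 64 := by rw [div_pow, hsq]; ring
  rw [h3] at h2
  rw [div_mul_eq_mul_div (7 : ℝ) δ, le_div_iff₀ hδ]
  have h4 : δ / 7 * (sphereUniform n).real {u | G u < 2 / 3 * √δ} ≤ Real.exp (-(n * δ / 64)) :=
    (mul_le_mul_of_nonneg_right h1 measureReal_nonneg).trans h2
  linarith

/-! ### Krylov spaces, Ritz values and the Lipschitz bound for residuals. -/

section Krylov

variable {E : Type*} [NormedAddCommGroup E] [InnerProductSpace ℂ E]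

theorem Submodule.orthogonal_starProjection_congr [FiniteDimensional ℂ E] {W : Submodule ℂ E}
    {x y : E} (h : x - y ∈ W) : Wᗮ.starProjection x = Wᗮ.starProjection y := by
  rw [← sub_eq_zero, ← map_sub]
  exact (Submodule.starProjection_apply_eq_zero_iff _).2 (W.le_orthogonal_orthogonal h)

theorem Submodule.sub_orthogonal_starProjection_mem [FiniteDimensional ℂ E] (W : Submodule ℂ E)
    (x : E) : x - Wᗮ.starProjection x ∈ W := by
  have h := Submodule.sub_starProjection_mem_orthogonal (K := Wᗮ) x
  rwa [Submodule.orthogonal_orthogonal] at h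

/-- The Krylov space spanned by `u, T u, …, T ^ (j - 1) u`. -/
def krylov (T : E →L[ℂ] E) (u : E) (j : ℕ) : Submodule ℂ E :=
  Submodule.span ℂ ((fun k : ℕ => (T ^ k) u) '' Set.Iio j)

/-- The component of `T ^ j u` orthogonal to the Krylov space of order `j`. -/
noncomputable def krylovResidual [FiniteDimensional ℂ E] (T : E →L[ℂ] E) (u : E) (j : ℕ) : E :=
  (krylov T u j)ᗮ.starProjection ((T ^ j) u)

theorem pow_apply_mem_krylov (T : E →L[ℂ] E) (u : E) {k j : ℕ} (h : k < j) :
    (T ^ k) u ∈ krylov T u j :=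
  Submodule.subset_span ⟨k, h, rfl⟩

theorem krylov_succ (T : E →L[ℂ] E) (u : E) (j : ℕ) :
    krylov T u (j + 1) = krylov T u j ⊔ Submodule.span ℂ {(T ^ j) u} := by
  rw [krylov, krylov, ← Submodule.span_union]
  congr 1
  ext x
  simp only [Set.mem_image, Set.mem_Iio, Set.mem_union, Set.mem_singleton_iff,
    Nat.lt_succ_iff_lt_or_eq]
  constructor
  · rintro ⟨k, hk | rfl, rfl⟩
    · exact Or.inl ⟨k, hk, rfl⟩
    · exact Or.inr rfl
  · rintro (⟨k, hk, rfl⟩ | rfl)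
    · exact ⟨k, Or.inl hk, rfl⟩
    · exact ⟨j, Or.inr rfl, rfl⟩

theorem apply_mem_krylov_succ {T : E →L[ℂ] E} {u x : E} {j : ℕ} (hx : x ∈ krylov T u j) :
    T x ∈ krylov T u (j + 1) := by
  have : krylov T u j ≤ (krylov T u (j + 1)).comap (T : E →ₗ[ℂ] E) := by
    refine Submodule.span_le.2 ?_
    rintro _ ⟨k, hk, rfl⟩
    have := pow_apply_mem_krylov T u (Nat.succ_lt_succ hk)
    rwa [Nat.succ_eq_add_one, pow_succ'] at this
  exact this hx

theorem krylov_succ_eq_sup_residual [FiniteDimensional ℂ E] (T : E →L[ℂ] E) (u : E) (j : ℕ) :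
    krylov T u (j + 1) = krylov T u j ⊔ Submodule.span ℂ {krylovResidual T u j} := by
  have h := (krylov T u j).sub_orthogonal_starProjection_mem ((T ^ j) u)
  rw [krylov_succ]
  apply le_antisymm
  · refine sup_le le_sup_left ((Submodule.span_singleton_le_iff_mem _ _).2 ?_)
    rw [← sub_add_cancel ((T ^ j) u) (krylovResidual T u j)]
    exact add_mem (Submodule.mem_sup_left h)
      (Submodule.mem_sup_right (Submodule.mem_span_singleton_self _))
  · refine sup_le le_sup_left ((Submodule.span_singleton_le_iff_mem _ _).2 ?_)
    rw [← sub_sub_cancel ((T ^ j) u) (krylovResidual T u j)]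
    exact sub_mem (Submodule.mem_sup_right (Submodule.mem_span_singleton_self _))
      (Submodule.mem_sup_left h)

/-- `T ^ j u` differs from its residual by an element of the Krylov space of order `j`, which `T`
maps into the next one. This lets the Lanczos recursion follow the residuals. -/
theorem starProjection_apply_krylovResidual [FiniteDimensional ℂ E] (T : E →L[ℂ] E) (u : E)
    (j : ℕ) : (krylov T u (j + 1))ᗮ.starProjection (T (krylovResidual T u j)) =
      krylovResidual T u (j + 1) := by
  refine Submodule.orthogonal_starProjection_congr ?_
  have h := apply_mem_krylov_succ
    ((krylov T u j).sub_orthogonal_starProjection_mem ((T ^ j) u))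
  rw [map_sub] at h
  rw [pow_succ', ← neg_mem_iff, neg_sub]
  exact h

theorem krylovResidual_zero [FiniteDimensional ℂ E] (T : E →L[ℂ] E) (u : E) :
    krylovResidual T u 0 = u := by
  have h := (krylov T u 0).sub_orthogonal_starProjection_mem u
  have h0 : krylov T u 0 = ⊥ := by simp [krylov]
  rw [h0, Submodule.mem_bot, sub_eq_zero] at h
  have h1 := h.symm
  simp only [← h0] at h1
  simpa [krylovResidual] using h1

theorem krylovResidual_succ_eq_zero [FiniteDimensional ℂ E] {T : E →L[ℂ] E} {u : E} {j : ℕ}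
    (h : krylovResidual T u j = 0) : krylovResidual T u (j + 1) = 0 := by
  rw [← starProjection_apply_krylovResidual, h, map_zero, map_zero]

theorem aeval_apply_of_eigenvector (T : E →L[ℂ] E) {x : E} {c : ℝ} (h : T x = (c : ℂ) • x)
    (p : Polynomial ℝ) : Polynomial.aeval T p x = ((p.eval c : ℝ) : ℂ) • x := by
  induction p using Polynomial.induction_on' with
  | add p q hp hq => simp [hp, hq, add_smul]
  | monomial k a =>
    have hk : (T ^ k) x = ((c : ℂ) ^ k) • x := by
      induction k with
      | zero => simp
      | succ k ih => rw [pow_succ', mul_apply_eq_comp, ih, map_smul, h, smul_smul,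
          pow_succ]
    rw [Polynomial.aeval_monomial, Polynomial.eval_monomial, mul_apply_eq_comp, hk,
      Algebra.algebraMap_eq_smul_one, smul_apply, one_apply_eq_self, ← Complex.coe_smul, smul_smul]
    simp

theorem inner_aeval_symm {T : E →L[ℂ] E} (hT : ∀ x y, inner ℂ (T x) y = inner ℂ x (T y))
    (p : Polynomial ℝ) (x y : E) :
    inner ℂ (Polynomial.aeval T p x) y = inner ℂ x (Polynomial.aeval T p y) := by
  induction p using Polynomial.induction_on' with
  | add p q hp hq => rw [map_add, add_apply, add_apply, inner_add_left, inner_add_right, hp, hq]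
  | monomial k a =>
    have hk : ∀ x y, inner ℂ ((T ^ k) x) y = inner ℂ x ((T ^ k) y) := by
      induction k with
      | zero => simp
      | succ k ih =>
        intro x y
        rw [pow_succ', mul_apply_eq_comp, hT, ih, ← mul_apply_eq_comp, ← pow_succ, pow_succ']
    rw [Polynomial.aeval_monomial, mul_apply_eq_comp, mul_apply_eq_comp,
      Algebra.algebraMap_eq_smul_one]
    simp only [smul_apply, one_apply_eq_self]
    rw [← Complex.coe_smul, ← Complex.coe_smul, inner_smul_left, inner_smul_right, hk,
      Complex.conj_ofReal]

theorem aeval_apply_mem_krylov (T : E →L[ℂ] E) (u : E) {p : Polynomial ℝ} {j : ℕ}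
    (hp : p.degree < j) : Polynomial.aeval T p u ∈ krylov T u j := by
  rcases eq_or_ne p 0 with rfl | h0
  · simp
  have hp' : p.natDegree < j := (Polynomial.natDegree_lt_iff_degree_lt h0).2 hp
  rw [Polynomial.aeval_eq_sum_range' hp', sum_apply]
  refine sum_mem fun k hk => ?_
  rw [smul_apply, ← Complex.coe_smul]
  exact Submodule.smul_mem _ _ (pow_apply_mem_krylov T u (Finset.mem_range.1 hk))

theorem aeval_sub_aeval_mem_krylov (T : E →L[ℂ] E) (u : E) {p q : Polynomial ℝ} {j : ℕ}
    (hp : p.Monic) (hq : q.Monic) (hpj : p.natDegree = j) (hqj : q.natDegree = j) :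
    Polynomial.aeval T p u - Polynomial.aeval T q u ∈ krylov T u j := by
  rw [← sub_apply, ← map_sub]
  refine aeval_apply_mem_krylov T u ?_
  have hdp : p.degree = j := by rw [Polynomial.degree_eq_natDegree hp.ne_zero, hpj]
  have hdq : q.degree = j := by rw [Polynomial.degree_eq_natDegree hq.ne_zero, hqj]
  rw [← hdp]
  exact Polynomial.degree_sub_lt_left (by rw [hdp, hdq]) hp.ne_zero (by rw [hp, hq])

/-- The monic polynomial with a given multiset of real roots. -/
noncomputable def monicOfRoots (t : Multiset ℝ) : Polynomial ℝ :=
  (t.map fun c => Polynomial.X - Polynomial.C c).prod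

theorem monic_monicOfRoots (t : Multiset ℝ) : (monicOfRoots t).Monic :=
  Polynomial.monic_multiset_prod_of_monic _ _ fun c _ => Polynomial.monic_X_sub_C c

theorem natDegree_monicOfRoots (t : Multiset ℝ) : (monicOfRoots t).natDegree = t.card :=
  Polynomial.natDegree_multiset_prod_X_sub_C_eq_card t

theorem eval_monicOfRoots (t : Multiset ℝ) (x : ℝ) :
    (monicOfRoots t).eval x = (t.map fun c => x - c).prod := by
  rw [monicOfRoots, Polynomial.eval_multiset_prod, Multiset.map_map]
  simp

theorem norm_aeval_monicOfRoots_apply_le (T : E →L[ℂ] E) {M : ℝ} (hM : ‖T‖ ≤ M)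
    {t : Multiset ℝ} (ht : ∀ c ∈ t, |c| ≤ M) (x : E) :
    ‖Polynomial.aeval T (monicOfRoots t) x‖ ≤ (2 * M) ^ t.card * ‖x‖ := by
  have hM0 : 0 ≤ M := (norm_nonneg _).trans hM
  induction t using Multiset.induction_on with
  | empty => simp [monicOfRoots]
  | cons c t ih =>
    have ih' := ih fun c hc => ht c (Multiset.mem_cons_of_mem hc)
    have hc := ht c (Multiset.mem_cons_self c t)
    have : monicOfRoots (c ::ₘ t) = (Polynomial.X - Polynomial.C c) * monicOfRoots t := by
      simp [monicOfRoots]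
    rw [this, map_mul, mul_apply_eq_comp, Multiset.card_cons, pow_succ]
    set y := Polynomial.aeval T (monicOfRoots t) x
    have h1 : Polynomial.aeval T (Polynomial.X - Polynomial.C c) y = T y - c • y := by
      simp [Algebra.algebraMap_eq_smul_one]
    rw [h1]
    calc ‖T y - c • y‖ ≤ ‖T y‖ + ‖c • y‖ := norm_sub_le _ _
      _ ≤ M * ‖y‖ + M * ‖y‖ := by
          refine add_le_add (T.le_of_opNorm_le hM y) ?_
          rw [norm_smul, Real.norm_eq_abs]
          gcongr
      _ = 2 * M * ‖y‖ := by ring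
      _ ≤ 2 * M * ((2 * M) ^ t.card * ‖x‖) := by gcongr
      _ = _ := by ring

/-- The compression of an operator to a subspace. -/
noncomputable def compression [FiniteDimensional ℂ E] (T : E →L[ℂ] E) (V : Submodule ℂ E) :
    V →L[ℂ] V :=
  V.orthogonalProjectionOnto ∘L T ∘L V.subtypeL

/-- All powers below `j` already lie in the Krylov space, so projecting after each step changes
nothing until the last one. Hence `k = j` is still allowed, as needed for monic polynomials of
degree `j`. -/
theorem compression_pow_apply [FiniteDimensional ℂ E] (T : E →L[ℂ] E) (u : E) {j : ℕ}
    (hu : u ∈ krylov T u j) {k : ℕ} (hk : k ≤ j) :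
    (krylov T u j).orthogonalProjectionOnto ((T ^ k) u) =
      (compression T (krylov T u j) ^ k) ⟨u, hu⟩ := by
  induction k with
  | zero => exact Submodule.orthogonalProjectionOnto_mem_subspace_eq_self (⟨u, hu⟩ : krylov T u j)
  | succ k ih =>
    have hmem := pow_apply_mem_krylov T u hk
    rw [pow_succ' (compression _ _), mul_apply_eq_comp, ← ih (by omega), compression]
    simp only [ContinuousLinearMap.comp_apply, Submodule.subtypeL_apply]
    rw [Submodule.orthogonalProjectionOnto_mem_subspace_eq_self
      (⟨_, hmem⟩ : krylov T u j), ← mul_apply_eq_comp,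
      ← pow_succ']

theorem orthogonalProjection_aeval_apply [FiniteDimensional ℂ E] (T : E →L[ℂ] E) (u : E) {j : ℕ}
    (hu : u ∈ krylov T u j) {p : Polynomial ℝ} (hp : p.natDegree ≤ j) :
    (krylov T u j).orthogonalProjectionOnto (Polynomial.aeval T p u) =
      Polynomial.aeval (compression T (krylov T u j)) p ⟨u, hu⟩ := by
  rw [Polynomial.aeval_eq_sum_range, Polynomial.aeval_eq_sum_range, sum_apply,
    sum_apply, map_sum]
  refine Finset.sum_congr rfl fun k hk => ?_
  rw [smul_apply, smul_apply, ← Complex.coe_smul,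
    ← Complex.coe_smul, map_smul,
    compression_pow_apply T u hu (by have := Finset.mem_range.1 hk; omega)]

theorem isSymmetric_compression [FiniteDimensional ℂ E] {T : E →L[ℂ] E}
    (hT : ∀ x y, inner ℂ (T x) y = inner ℂ x (T y)) (V : Submodule ℂ E) :
    (compression T V : V →ₗ[ℂ] V).IsSymmetric := by
  intro x y
  simp only [compression, ContinuousLinearMap.coe_coe, ContinuousLinearMap.comp_apply,
    Submodule.subtypeL_apply, Submodule.inner_orthogonalProjectionOnto_eq_of_mem_left,
    Submodule.inner_orthogonalProjectionOnto_eq_of_mem_right, hT]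

theorem norm_compression_apply_le [FiniteDimensional ℂ E] (T : E →L[ℂ] E) {M : ℝ} (hM : ‖T‖ ≤ M)
    (V : Submodule ℂ E) (x : V) : ‖compression T V x‖ ≤ M * ‖x‖ := by
  simp only [compression, ContinuousLinearMap.comp_apply, Submodule.subtypeL_apply]
  exact (Submodule.norm_orthogonalProjectionOnto_apply_le _ _).trans (T.le_of_opNorm_le hM _)

/-- The Krylov residual is obtained by applying a monic real polynomial whose roots, the Ritz
values, are real and bounded by the norm of the operator. -/
theorem exists_monicOfRoots_aeval_eq_krylovResidual [FiniteDimensional ℂ E] {T : E →L[ℂ] E}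
    (hT : ∀ x y, inner ℂ (T x) y = inner ℂ x (T y)) {M : ℝ} (hM : ‖T‖ ≤ M) (u : E) (j : ℕ) :
    ∃ t : Multiset ℝ, t.card = j ∧ (∀ c ∈ t, |c| ≤ M) ∧
      Polynomial.aeval T (monicOfRoots t) u = krylovResidual T u j := by
  have hM0 : 0 ≤ M := (norm_nonneg _).trans hM
  rcases Nat.eq_zero_or_pos j with rfl | hj
  · exact ⟨0, rfl, by simp, by simp [monicOfRoots, krylovResidual_zero]⟩
  have hu : u ∈ krylov T u j := by simpa using pow_apply_mem_krylov T u hj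
  classical
  set V := krylov T u j with hV
  set C := compression T V
  have hC : (C : V →ₗ[ℂ] V).IsSymmetric := isSymmetric_compression hT V
  set d := Module.finrank ℂ V with hd
  have hdj : d ≤ j := by
    have h1 : V = Submodule.span ℂ
        (((Finset.range j).image fun k => (T ^ k) u : Finset E) : Set E) := by
      rw [hV, krylov, Finset.coe_image, Finset.coe_range]
    have h2 := finrank_span_finset_le_card (R := ℂ) ((Finset.range j).image fun k => (T ^ k) u)
    rw [Set.finrank, ← h1] at h2
    exact h2.trans (Finset.card_image_le.trans (by simp))
  set θ := hC.eigenvalues hd.symm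
  set b := hC.eigenvectorBasis hd.symm
  have hb : ∀ l, C (b l) = ((θ l : ℝ) : ℂ) • b l := fun l => hC.apply_eigenvectorBasis hd.symm l
  have hθ : ∀ l, |θ l| ≤ M := by
    intro l
    have h1 := norm_compression_apply_le T hM V (b l)
    change ‖C (b l)‖ ≤ _ at h1
    rw [hb, norm_smul, b.norm_eq_one, mul_one, mul_one] at h1
    simpa using h1
  set t₀ : Multiset ℝ := Finset.univ.val.map θ with ht₀
  set t : Multiset ℝ := t₀ + Multiset.replicate (j - d) 0 with ht
  have hcard : t.card = j := by
    rw [ht, ht₀, Multiset.card_add, Multiset.card_map, Multiset.card_replicate]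
    simp only [Finset.card_val, Finset.card_univ, Fintype.card_fin]
    omega
  have hzero : Polynomial.aeval C (monicOfRoots t₀) = 0 := by
    have : (Polynomial.aeval C (monicOfRoots t₀) : V →ₗ[ℂ] V) = 0 := by
      refine b.toBasis.ext fun l => ?_
      simp only [OrthonormalBasis.coe_toBasis, ContinuousLinearMap.coe_coe, LinearMap.zero_apply]
      rw [aeval_apply_of_eigenvector C (hb l), eval_monicOfRoots]
      have : (t₀.map fun c => θ l - c).prod = 0 := by
        refine Multiset.prod_eq_zero (Multiset.mem_map.2 ⟨θ l, ?_, sub_self _⟩)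
        exact Multiset.mem_map.2 ⟨l, Finset.mem_univ_val l, rfl⟩
      rw [this]; simp
    ext x
    exact congrArg Subtype.val (LinearMap.congr_fun this x)
  have hzero' : Polynomial.aeval C (monicOfRoots t) = 0 := by
    rw [ht, monicOfRoots, Multiset.map_add, Multiset.prod_add, map_mul]
    change Polynomial.aeval C (monicOfRoots t₀) * _ = 0
    rw [hzero, zero_mul]
  refine ⟨t, hcard, ?_, ?_⟩
  · intro c hc
    rcases Multiset.mem_add.1 hc with hc | hc
    · obtain ⟨l, -, rfl⟩ := Multiset.mem_map.1 hc
      exact hθ l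
    · rw [Multiset.eq_of_mem_replicate hc]; simpa using hM0
  · have h1 : V.orthogonalProjectionOnto (Polynomial.aeval T (monicOfRoots t) u) = 0 := by
      rw [hV, orthogonalProjection_aeval_apply T u hu (by rw [natDegree_monicOfRoots, hcard])]
      change Polynomial.aeval C (monicOfRoots t) _ = 0
      rw [hzero']; rfl
    have h2 : Polynomial.aeval T (monicOfRoots t) u ∈ Vᗮ :=
      Submodule.orthogonalProjectionOnto_eq_zero_iff.1 h1
    rw [← Submodule.starProjection_eq_self_iff.2 h2]
    refine Submodule.orthogonal_starProjection_congr ?_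
    have h3 := aeval_sub_aeval_mem_krylov T u (monic_monicOfRoots t) (Polynomial.monic_X_pow j)
      (by rw [natDegree_monicOfRoots, hcard]) (Polynomial.natDegree_X_pow j)
    simpa using h3

/-- The Krylov residual is a Lipschitz function of the starting vector. -/
theorem norm_krylovResidual_sub_le [FiniteDimensional ℂ E] {T : E →L[ℂ] E}
    (hT : ∀ x y, inner ℂ (T x) y = inner ℂ x (T y)) {M : ℝ} (hM : ‖T‖ ≤ M) (u w : E) (j : ℕ) :
    ‖krylovResidual T u j - krylovResidual T w j‖ ≤ (2 * M) ^ j * ‖u - w‖ := by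
  have hM0 : 0 ≤ M := (norm_nonneg _).trans hM
  obtain ⟨s, hsj, hsM, hs⟩ := exists_monicOfRoots_aeval_eq_krylovResidual hT hM u j
  obtain ⟨t, htj, htM, ht⟩ := exists_monicOfRoots_aeval_eq_krylovResidual hT hM w j
  set P := Polynomial.aeval T (monicOfRoots s) with hP
  set Q := Polynomial.aeval T (monicOfRoots t) with hQ
  have hPQ : ∀ x, P x - Q x ∈ krylov T x j := fun x =>
    aeval_sub_aeval_mem_krylov T x (monic_monicOfRoots s) (monic_monicOfRoots t)
      (by rw [natDegree_monicOfRoots, hsj]) (by rw [natDegree_monicOfRoots, htj])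
  have hu : inner ℂ (P u) (Q u) = inner ℂ (P u) (P u) := by
    have h1 : inner ℂ (P u - Q u) (krylovResidual T u j) = 0 :=
      Submodule.inner_right_of_mem_orthogonal (hPQ u) (Submodule.starProjection_apply_mem _ _)
    rw [← hs, inner_sub_left, sub_eq_zero] at h1
    rw [← inner_conj_symm, ← h1, inner_conj_symm, h1]
  have hw : inner ℂ (P w) (Q w) = inner ℂ (Q w) (Q w) := by
    have h1 : inner ℂ (P w - Q w) (krylovResidual T w j) = 0 :=
      Submodule.inner_right_of_mem_orthogonal (hPQ w) (Submodule.starProjection_apply_mem _ _)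
    rw [← ht, inner_sub_left, sub_eq_zero] at h1
    exact h1
  have hcross : inner ℂ (P w) (Q u) = inner ℂ (Q w) (P u) := by
    rw [hP, hQ, inner_aeval_symm hT, inner_aeval_symm hT, ← mul_apply_eq_comp,
      ← mul_apply_eq_comp, ← map_mul, ← map_mul, mul_comm]
  -- Expanding the right side gives `⟨Pu, Qu⟩ = ‖Pu‖²` and `⟨Pw, Qw⟩ = ‖Qw‖²` by orthogonality of
  -- the residuals to the Krylov spaces. Since `P` and `Q` are commuting and symmetric, the cross
  -- terms are those of the left side.
  have hkey : ‖P u - Q w‖ ^ 2 = (inner ℂ (P (u - w)) (Q (u - w))).re := by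
    rw [map_sub, map_sub, inner_sub_left, inner_sub_right, inner_sub_right, hu, hw, hcross,
      @norm_sub_sq ℂ, ← @inner_self_eq_norm_sq ℂ, ← @inner_self_eq_norm_sq ℂ]
    have h2 : (inner ℂ (Q w) (P u)).re = (inner ℂ (P u) (Q w)).re := by
      rw [← inner_conj_symm, Complex.conj_re]
    simp only [Complex.sub_re, RCLike.re_to_complex, h2]
    ring
  rw [← hs, ← ht]
  refine (sq_le_sq₀ (norm_nonneg _) (by positivity)).1 ?_
  rw [hkey]
  calc (inner ℂ (P (u - w)) (Q (u - w))).re ≤ ‖inner ℂ (P (u - w)) (Q (u - w))‖ :=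
        Complex.re_le_norm _
    _ ≤ ‖P (u - w)‖ * ‖Q (u - w)‖ := norm_inner_le_norm _ _
    _ ≤ ((2 * M) ^ j * ‖u - w‖) * ((2 * M) ^ j * ‖u - w‖) := by
        have h1 := norm_aeval_monicOfRoots_apply_le T hM hsM (u - w)
        have h2 := norm_aeval_monicOfRoots_apply_le T hM htM (u - w)
        rw [hsj] at h1
        rw [htj] at h2
        gcongr
    _ = _ := by ring

end Krylov

/-! ### Jacobi coefficients in terms of Krylov residuals. -/

section Lanczos

variable {n : ℕ}

theorem toEuclideanCLM_inner_symm {A : Matrix (Fin n) (Fin n) ℂ} (hA : A.IsHermitian)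
    (x y : EuclideanSpace ℂ (Fin n)) :
    inner ℂ (Matrix.toEuclideanCLM (n := Fin n) (𝕜 := ℂ) A x) y =
      inner ℂ x (Matrix.toEuclideanCLM (n := Fin n) (𝕜 := ℂ) A y) :=
  (Matrix.isSymmetric_toEuclideanLin_iff.2 hA) x y

/-- Both sides satisfy the same recursion up to a positive scalar, removed by normalization. It
persists after breakdown because residuals then stay zero and `0⁻¹ = 0`. -/
theorem lanczosState_eq (A : Matrix (Fin n) (Fin n) ℂ) {u : EuclideanSpace ℂ (Fin n)}
    (hu : ‖u‖ = 1) (j : ℕ) :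
    lanczosState A u j =
      (((‖krylovResidual (Matrix.toEuclideanCLM (n := Fin n) (𝕜 := ℂ) A) u j‖⁻¹ : ℝ) : ℂ) •
        krylovResidual (Matrix.toEuclideanCLM (n := Fin n) (𝕜 := ℂ) A) u j,
        krylov (Matrix.toEuclideanCLM (n := Fin n) (𝕜 := ℂ) A) u (j + 1)) := by
  set T := Matrix.toEuclideanCLM (n := Fin n) (𝕜 := ℂ) A with hT
  induction j with
  | zero =>
    rw [krylovResidual_zero, hu, krylov_succ_eq_sup_residual, krylovResidual_zero]
    simp [lanczosState, krylov]
  | succ j ih =>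
    have hres : lanczosResidual A (lanczosState A u j).1 (lanczosState A u j).2 =
        ((‖krylovResidual T u j‖⁻¹ : ℝ) : ℂ) • krylovResidual T u (j + 1) := by
      rw [ih, lanczosResidual, ← hT, map_smul, map_smul, starProjection_apply_krylovResidual]
    have hv : ((‖lanczosResidual A (lanczosState A u j).1 (lanczosState A u j).2‖⁻¹ : ℝ) : ℂ) •
        lanczosResidual A (lanczosState A u j).1 (lanczosState A u j).2 =
        ((‖krylovResidual T u (j + 1)‖⁻¹ : ℝ) : ℂ) • krylovResidual T u (j + 1) := by
      rw [hres]
      rcases eq_or_ne (krylovResidual T u j) 0 with h0 | h0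
      · simp [krylovResidual_succ_eq_zero h0]
      · have h1 : ‖krylovResidual T u j‖ ≠ 0 := norm_ne_zero_iff.2 h0
        rw [smul_smul, norm_smul, Complex.norm_real, norm_inv, norm_norm, ← Complex.ofReal_mul]
        congr 2
        rw [mul_inv, inv_inv, mul_comm, ← mul_assoc, inv_mul_cancel₀ h1, one_mul]
    rw [lanczosState]
    simp only [hv]
    rw [ih, krylov_succ_eq_sup_residual T u (j + 1)]
    rcases eq_or_ne (krylovResidual T u (j + 1)) 0 with h0 | h0
    · simp [h0]
    · have h1 : ((‖krylovResidual T u (j + 1)‖⁻¹ : ℝ) : ℂ) ≠ 0 := by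
        rw [Complex.ofReal_ne_zero]
        exact inv_ne_zero (norm_ne_zero_iff.2 h0)
      rw [Submodule.span_singleton_smul_eq (IsUnit.mk0 _ h1)]

theorem norm_lanczosState_fst_le (A : Matrix (Fin n) (Fin n) ℂ) {u : EuclideanSpace ℂ (Fin n)}
    (hu : ‖u‖ = 1) (j : ℕ) : ‖(lanczosState A u j).1‖ ≤ 1 := by
  rw [lanczosState_eq A hu, norm_smul, Complex.norm_real, norm_inv, norm_norm]
  exact inv_mul_le_one

theorem jacobiBeta_eq (A : Matrix (Fin n) (Fin n) ℂ) {u : EuclideanSpace ℂ (Fin n)}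
    (hu : ‖u‖ = 1) (j : ℕ) : jacobiBeta A j u =
      ‖krylovResidual (Matrix.toEuclideanCLM (n := Fin n) (𝕜 := ℂ) A) u (j + 1)‖ /
        ‖krylovResidual (Matrix.toEuclideanCLM (n := Fin n) (𝕜 := ℂ) A) u j‖ := by
  rw [jacobiBeta, lanczosState_eq A hu, lanczosResidual, map_smul, map_smul,
    starProjection_apply_krylovResidual, norm_smul, Complex.norm_real, norm_inv, norm_norm,
    div_eq_inv_mul]

theorem abs_jacobiAlpha_le (A : Matrix (Fin n) (Fin n) ℂ) {u : EuclideanSpace ℂ (Fin n)}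
    (hu : ‖u‖ = 1) (j : ℕ) : |jacobiAlpha A j u| ≤ matrixOpNorm A := by
  have h1 := norm_lanczosState_fst_le A hu j
  set v := (lanczosState A u j).1 with hv
  rw [jacobiAlpha, ← hv]
  have h2 : ‖Matrix.toEuclideanCLM (n := Fin n) (𝕜 := ℂ) A v‖ ≤ matrixOpNorm A * ‖v‖ :=
    ContinuousLinearMap.le_opNorm _ v
  have h3 : 0 ≤ matrixOpNorm A := norm_nonneg _
  calc _ ≤ ‖inner ℂ v (Matrix.toEuclideanCLM (n := Fin n) (𝕜 := ℂ) A v)‖ := Complex.abs_re_le_norm _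
    _ ≤ ‖v‖ * ‖Matrix.toEuclideanCLM (n := Fin n) (𝕜 := ℂ) A v‖ := norm_inner_le_norm _ _
    _ ≤ 1 * (matrixOpNorm A * 1) := by gcongr; exact h2.trans (by gcongr)
    _ = _ := by ring

theorem jacobiBeta_nonneg (A : Matrix (Fin n) (Fin n) ℂ) (u : EuclideanSpace ℂ (Fin n)) (j : ℕ) :
    0 ≤ jacobiBeta A j u := norm_nonneg _

theorem jacobiBeta_le (A : Matrix (Fin n) (Fin n) ℂ) {u : EuclideanSpace ℂ (Fin n)}
    (hu : ‖u‖ = 1) (j : ℕ) : jacobiBeta A j u ≤ matrixOpNorm A := by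
  have h1 := norm_lanczosState_fst_le A hu j
  have h3 : 0 ≤ matrixOpNorm A := norm_nonneg _
  rw [jacobiBeta, lanczosResidual]
  refine (Submodule.norm_starProjection_apply_le _ _).trans ?_
  refine (ContinuousLinearMap.le_opNorm _ _).trans ?_
  exact mul_le_of_le_one_right h3 h1

/-- The squared left norm times `‖a‖ ‖b‖` equals `2 ‖a‖ ‖b‖ - 2 Re ⟨a, b⟩`, which is `‖a - b‖² -
(‖a‖ - ‖b‖)²`. -/
theorem norm_normalize_sub_le {E : Type*} [NormedAddCommGroup E] [InnerProductSpace ℂ E] {a b : E}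
    {κ : ℝ} (hκ : 0 < κ) (ha : κ ≤ ‖a‖) (hb : κ ≤ ‖b‖) :
    ‖((‖a‖⁻¹ : ℝ) : ℂ) • a - ((‖b‖⁻¹ : ℝ) : ℂ) • b‖ ≤ ‖a - b‖ / κ := by
  have ha0 : 0 < ‖a‖ := hκ.trans_le ha
  have hb0 : 0 < ‖b‖ := hκ.trans_le hb
  rw [le_div_iff₀ hκ]
  refine (sq_le_sq₀ (by positivity) (norm_nonneg _)).1 ?_
  set r := RCLike.re (inner ℂ a b) with hr
  have h1 : ‖((‖a‖⁻¹ : ℝ) : ℂ) • a - ((‖b‖⁻¹ : ℝ) : ℂ) • b‖ ^ 2 * (‖a‖ * ‖b‖) =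
      2 * (‖a‖ * ‖b‖) - 2 * r := by
    rw [@norm_sub_sq ℂ, norm_smul, norm_smul, inner_smul_left, inner_smul_right,
      Complex.conj_ofReal]
    have h2 : RCLike.re (((‖a‖⁻¹ : ℝ) : ℂ) * (((‖b‖⁻¹ : ℝ) : ℂ) * inner ℂ a b)) =
        ‖a‖⁻¹ * (‖b‖⁻¹ * r) := by
      rw [hr]
      simp only [RCLike.re_to_complex, Complex.re_ofReal_mul]
    rw [h2, Complex.norm_real, Complex.norm_real, norm_inv, norm_inv, norm_norm, norm_norm,
      inv_mul_cancel₀ ha0.ne', inv_mul_cancel₀ hb0.ne']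
    field_simp
    ring
  rw [mul_pow, @norm_sub_sq ℂ _ _ _ _ a b, ← hr]
  have h3 : κ ^ 2 ≤ ‖a‖ * ‖b‖ := by rw [sq]; gcongr
  calc _ ≤ ‖((‖a‖⁻¹ : ℝ) : ℂ) • a - ((‖b‖⁻¹ : ℝ) : ℂ) • b‖ ^ 2 * (‖a‖ * ‖b‖) := by gcongr
    _ = 2 * (‖a‖ * ‖b‖) - 2 * r := h1
    _ ≤ _ := by nlinarith [sq_nonneg (‖a‖ - ‖b‖)]

theorem abs_jacobiAlpha_sub_le {A : Matrix (Fin n) (Fin n) ℂ} (hA : A.IsHermitian)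
    {u w : EuclideanSpace ℂ (Fin n)} (hu : ‖u‖ = 1) (hw : ‖w‖ = 1) (j : ℕ) {κ : ℝ} (hκ : 0 < κ)
    (hκu : κ ≤ ‖krylovResidual (Matrix.toEuclideanCLM (n := Fin n) (𝕜 := ℂ) A) u j‖)
    (hκw : κ ≤ ‖krylovResidual (Matrix.toEuclideanCLM (n := Fin n) (𝕜 := ℂ) A) w j‖) :
    |jacobiAlpha A j u - jacobiAlpha A j w| ≤
      2 * matrixOpNorm A * (2 * matrixOpNorm A) ^ j / κ * ‖u - w‖ := by
  have hM : 0 ≤ matrixOpNorm A := norm_nonneg _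
  have hv := norm_lanczosState_fst_le A hu j
  have hv' := norm_lanczosState_fst_le A hw j
  have hd : ‖(lanczosState A u j).1 - (lanczosState A w j).1‖ ≤
      (2 * matrixOpNorm A) ^ j / κ * ‖u - w‖ := by
    rw [lanczosState_eq A hu, lanczosState_eq A hw]
    refine (norm_normalize_sub_le hκ hκu hκw).trans ?_
    rw [div_mul_eq_mul_div]
    gcongr
    exact norm_krylovResidual_sub_le (toEuclideanCLM_inner_symm hA) le_rfl u w j
  rw [jacobiAlpha, jacobiAlpha]
  set T := Matrix.toEuclideanCLM (n := Fin n) (𝕜 := ℂ) A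
  set v := (lanczosState A u j).1
  set v' := (lanczosState A w j).1
  have hT : ∀ x, ‖T x‖ ≤ matrixOpNorm A * ‖x‖ := fun x => ContinuousLinearMap.le_opNorm _ x
  have hsplit : inner ℂ v (T v) - inner ℂ v' (T v') =
      inner ℂ (v - v') (T v) + inner ℂ v' (T (v - v')) := by
    rw [map_sub, inner_sub_left, inner_sub_right]; ring
  rw [← Complex.sub_re, hsplit]
  calc _ ≤ ‖inner ℂ (v - v') (T v) + inner ℂ v' (T (v - v'))‖ := Complex.abs_re_le_norm _
    _ ≤ ‖v - v'‖ * ‖T v‖ + ‖v'‖ * ‖T (v - v')‖ :=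
        (norm_add_le _ _).trans (add_le_add (norm_inner_le_norm _ _) (norm_inner_le_norm _ _))
    _ ≤ ‖v - v'‖ * (matrixOpNorm A * 1) + 1 * (matrixOpNorm A * ‖v - v'‖) := by
        gcongr
        · exact (hT v).trans (by gcongr)
        · exact hT _
    _ = 2 * matrixOpNorm A * ‖v - v'‖ := by ring
    _ ≤ 2 * matrixOpNorm A * ((2 * matrixOpNorm A) ^ j / κ * ‖u - w‖) := by gcongr
    _ = _ := by ring

theorem abs_jacobiBeta_sub_le {A : Matrix (Fin n) (Fin n) ℂ} (hA : A.IsHermitian)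
    {u w : EuclideanSpace ℂ (Fin n)} (hu : ‖u‖ = 1) (hw : ‖w‖ = 1) (j : ℕ) {κ : ℝ} (hκ : 0 < κ)
    (hκu : κ ≤ ‖krylovResidual (Matrix.toEuclideanCLM (n := Fin n) (𝕜 := ℂ) A) u j‖)
    (hκw : κ ≤ ‖krylovResidual (Matrix.toEuclideanCLM (n := Fin n) (𝕜 := ℂ) A) w j‖) :
    |jacobiBeta A j u - jacobiBeta A j w| ≤
      3 * matrixOpNorm A * (2 * matrixOpNorm A) ^ j / κ * ‖u - w‖ := by
  have hM : 0 ≤ matrixOpNorm A := norm_nonneg _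
  have hb := jacobiBeta_le A hw j
  have hb0 := jacobiBeta_nonneg A w j
  have h1 := (abs_norm_sub_norm_le _ _).trans
    (norm_krylovResidual_sub_le (toEuclideanCLM_inner_symm hA) le_rfl u w j)
  have h2 := (abs_norm_sub_norm_le _ _).trans
    (norm_krylovResidual_sub_le (toEuclideanCLM_inner_symm hA) le_rfl u w (j + 1))
  change _ ≤ (2 * matrixOpNorm A) ^ j * ‖u - w‖ at h1
  change _ ≤ (2 * matrixOpNorm A) ^ (j + 1) * ‖u - w‖ at h2
  have hw' := jacobiBeta_eq A hw j
  rw [jacobiBeta_eq A hu]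
  set b := jacobiBeta A j w
  set T := Matrix.toEuclideanCLM (n := Fin n) (𝕜 := ℂ) A
  set x := ‖krylovResidual T u (j + 1)‖
  set y := ‖krylovResidual T u j‖
  set x' := ‖krylovResidual T w (j + 1)‖
  set y' := ‖krylovResidual T w j‖
  have hy : 0 < y := hκ.trans_le hκu
  have hy' : 0 < y' := hκ.trans_le hκw
  have hx' : x' = b * y' := by rw [hw']; field_simp
  -- This form divides only by `y` and uses `b ≤ ‖A‖`. The numerator then costs `(2‖A‖) ^ (j + 1) +
  -- ‖A‖ (2‖A‖) ^ j`, the source of the factor three.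
  have hsplit : x / y - b = ((x - x') - b * (y - y')) / y := by
    rw [hx']; field_simp; ring
  rw [hsplit, abs_div, abs_of_pos hy]
  have hnum : |(x - x') - b * (y - y')| ≤
      3 * matrixOpNorm A * (2 * matrixOpNorm A) ^ j * ‖u - w‖ := by
    calc _ ≤ |x - x'| + |b * (y - y')| := abs_sub _ _
      _ ≤ (2 * matrixOpNorm A) ^ (j + 1) * ‖u - w‖ +
          matrixOpNorm A * ((2 * matrixOpNorm A) ^ j * ‖u - w‖) := by
          rw [abs_mul, abs_of_nonneg hb0]
          gcongr
      _ = _ := by ring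
  calc _ ≤ 3 * matrixOpNorm A * (2 * matrixOpNorm A) ^ j * ‖u - w‖ / y := by gcongr
    _ ≤ 3 * matrixOpNorm A * (2 * matrixOpNorm A) ^ j * ‖u - w‖ / κ := by gcongr
    _ = _ := by ring

/-- At order zero the denominator is one, which improves the constant from `3` to `2`. The case `i =
0` needs this: `3` would give the exponent `t² n / 36`, short of `t² n / 32` when `δ = 1`. -/
theorem abs_jacobiBeta_zero_sub_le {A : Matrix (Fin n) (Fin n) ℂ} (hA : A.IsHermitian)
    {u w : EuclideanSpace ℂ (Fin n)} (hu : ‖u‖ = 1) (hw : ‖w‖ = 1) :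
    |jacobiBeta A 0 u - jacobiBeta A 0 w| ≤ 2 * matrixOpNorm A * ‖u - w‖ := by
  have h2 := (abs_norm_sub_norm_le _ _).trans
    (norm_krylovResidual_sub_le (toEuclideanCLM_inner_symm hA) le_rfl u w 1)
  rw [jacobiBeta_eq A hu, jacobiBeta_eq A hw, krylovResidual_zero, krylovResidual_zero, hu, hw,
    div_one, div_one]
  rwa [pow_one] at h2

theorem abs_eigenvalues_le {A : Matrix (Fin n) (Fin n) ℂ} (hA : A.IsHermitian) (k : Fin n) :
    |hA.eigenvalues k| ≤ matrixOpNorm A := by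
  have h1 := (Matrix.toEuclideanCLM (n := Fin n) (𝕜 := ℂ) A).le_opNorm (hA.eigenvectorBasis k)
  have h2 : Matrix.toEuclideanCLM (n := Fin n) (𝕜 := ℂ) A (hA.eigenvectorBasis k) =
      ((hA.eigenvalues k : ℝ) : ℂ) • hA.eigenvectorBasis k := by
    ext l
    have := congrFun (hA.mulVec_eigenvectorBasis k) l
    simpa using this
  rw [h2, norm_smul, OrthonormalBasis.norm_eq_one, mul_one, mul_one] at h1
  simpa [matrixOpNorm] using h1

theorem norm_aeval_apply_sq {A : Matrix (Fin n) (Fin n) ℂ} (hA : A.IsHermitian)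
    (p : Polynomial ℝ) (u : EuclideanSpace ℂ (Fin n)) :
    ‖Polynomial.aeval (Matrix.toEuclideanCLM (n := Fin n) (𝕜 := ℂ) A) p u‖ ^ 2 =
      ∑ k, p.eval (hA.eigenvalues k) ^ 2 * ‖inner ℂ (hA.eigenvectorBasis k) u‖ ^ 2 := by
  rw [← hA.eigenvectorBasis.sum_sq_norm_inner_right]
  refine Finset.sum_congr rfl fun k _ => ?_
  have h2 : Matrix.toEuclideanCLM (n := Fin n) (𝕜 := ℂ) A (hA.eigenvectorBasis k) =
      ((hA.eigenvalues k : ℝ) : ℂ) • hA.eigenvectorBasis k := by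
    ext l
    have := congrFun (hA.mulVec_eigenvectorBasis k) l
    simpa using this
  rw [← inner_aeval_symm (toEuclideanCLM_inner_symm hA), aeval_apply_of_eigenvector _ h2,
    inner_smul_left, norm_mul, mul_pow]
  simp

end Lanczos

/-! ### Rounding of roots, and equidistribution with multiplicity. -/

section Rounding

/-- The points `(3 x + y) / 4` and `(x + y) / 2` for `x`, `y` in the range of `lam`. -/
noncomputable def roundingPoint {n : ℕ} (lam : Fin n → ℝ) (c : Fin n × Fin n × Bool) : ℝ :=
  if c.2.2 then (lam c.1 + lam c.2.1) / 2 else (3 * lam c.1 + lam c.2.1) / 4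

/-- Every real is as far from all points `lam k` as some rounding point, up to a factor `5 / 4`. -/
theorem exists_roundingPoint {n : ℕ} [NeZero n] (lam : Fin n → ℝ) (t : ℝ) :
    ∃ c, ∀ k, |lam k - roundingPoint lam c| ≤ 5 / 4 * |lam k - t| := by
  classical
  have key : ∀ z : ℝ, (∃ c, roundingPoint lam c = z) →
      (∀ k, |lam k - z| ≤ 5 / 4 * |lam k - t|) →
      ∃ c, ∀ k, |lam k - roundingPoint lam c| ≤ 5 / 4 * |lam k - t| := by
    rintro z ⟨c, rfl⟩ h
    exact ⟨c, h⟩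
  have hself : ∀ a, ∃ c, roundingPoint lam c = lam a :=
    fun a => ⟨(a, a, true), by simp [roundingPoint]⟩
  have hmid : ∀ a b, ∃ c, roundingPoint lam c = (lam a + lam b) / 2 :=
    fun a b => ⟨(a, b, true), by simp [roundingPoint]⟩
  have hquarter : ∀ a b, ∃ c, roundingPoint lam c = (3 * lam a + lam b) / 4 :=
    fun a b => ⟨(a, b, false), by simp [roundingPoint]⟩
  have habs : ∀ {x z : ℝ}, (x ≤ t → x ≤ z ∧ z - x ≤ 5 / 4 * (t - x) ∨ z ≤ x ∧
      x - z ≤ 5 / 4 * (t - x)) → (t ≤ x → x ≤ z ∧ z - x ≤ 5 / 4 * (x - t) ∨ z ≤ x ∧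
      x - z ≤ 5 / 4 * (x - t)) → |x - z| ≤ 5 / 4 * |x - t| := by
    intro x z h1 h2
    rcases le_total x t with h | h
    · rw [abs_of_nonpos (sub_nonpos.2 h)]
      rcases h1 h with ⟨h3, h4⟩ | ⟨h3, h4⟩
      · rw [abs_of_nonpos (by linarith)]; linarith
      · rw [abs_of_nonneg (by linarith)]; linarith
    · rw [abs_of_nonneg (sub_nonneg.2 h)]
      rcases h2 h with ⟨h3, h4⟩ | ⟨h3, h4⟩
      · rw [abs_of_nonpos (by linarith)]; linarith
      · rw [abs_of_nonneg (by linarith)]; linarith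
  by_cases hlo : ∃ k, lam k ≤ t
  · obtain ⟨a, ha, hamax⟩ := Finset.exists_max_image (Finset.univ.filter fun k => lam k ≤ t) lam
      (by obtain ⟨k, hk⟩ := hlo; exact ⟨k, by simpa using hk⟩)
    replace ha : lam a ≤ t := by simpa using ha
    replace hamax : ∀ k, lam k ≤ t → lam k ≤ lam a := fun k hk => hamax k (by simpa using hk)
    by_cases hhi : ∃ k, t ≤ lam k
    · obtain ⟨b, hb, hbmin⟩ := Finset.exists_min_image (Finset.univ.filter fun k => t ≤ lam k) lam
        (by obtain ⟨k, hk⟩ := hhi; exact ⟨k, by simpa using hk⟩)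
      replace hb : t ≤ lam b := by simpa using hb
      replace hbmin : ∀ k, t ≤ lam k → lam b ≤ lam k := fun k hk => hbmin k (by simpa using hk)
      -- With `t` at relative position `s` between the neighbouring values `lam a` and `lam b`, the
      -- thresholds `1/5, …, 4/5` select the relative positions `0, 1/4, 1/2, 3/4, 1`. The factor `5
      -- / 4` then holds at `lam a` and `lam b`, hence at all values beyond them.
      rcases le_total (5 * (t - lam a)) (lam b - lam a) with h1 | h1
      · refine key _ (hself a) fun k => habs (fun h => Or.inl ?_) fun h => Or.inr ?_
        · have := hamax k h; constructor <;> linarith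
        · have := hbmin k h; constructor <;> linarith
      rcases le_total (5 * (t - lam a)) (2 * (lam b - lam a)) with h2 | h2
      · refine key _ (hquarter a b) fun k => habs (fun h => Or.inl ?_) fun h => Or.inr ?_
        · have := hamax k h; constructor <;> linarith
        · have := hbmin k h; constructor <;> linarith
      rcases le_total (5 * (t - lam a)) (3 * (lam b - lam a)) with h3 | h3
      · refine key _ (hmid a b) fun k => habs (fun h => Or.inl ?_) fun h => Or.inr ?_
        · have := hamax k h; constructor <;> linarith
        · have := hbmin k h; constructor <;> linarith
      rcases le_total (5 * (t - lam a)) (4 * (lam b - lam a)) with h4 | h4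
      · refine key _ (hquarter b a) fun k => habs (fun h => Or.inl ?_) fun h => Or.inr ?_
        · have := hamax k h; constructor <;> linarith
        · have := hbmin k h; constructor <;> linarith
      · refine key _ (hself b) fun k => habs (fun h => Or.inl ?_) fun h => Or.inr ?_
        · have := hamax k h; constructor <;> linarith
        · have := hbmin k h; constructor <;> linarith
    · push Not at hhi
      refine key _ (hself a) fun k => habs (fun h => Or.inl ?_) fun h => Or.inr ?_
      · have := hamax k h; constructor <;> linarith
      · have := hhi k; constructor <;> linarith
  · push Not at hlo
    obtain ⟨b, -, hbmin⟩ := Finset.exists_min_image Finset.univ lam Finset.univ_nonempty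
    refine key _ (hself b) fun k => habs (fun h => Or.inl ?_) fun h => Or.inr ?_
    · have := hlo k; constructor <;> linarith
    · have h1 := hbmin k (Finset.mem_univ _); have h2 := hlo b; constructor <;> linarith

/-- Equidistribution extends to points counted with multiplicity. -/
theorem IsEquidistributed.le_ncard_prod {n : ℕ} {lam : Fin n → ℝ} {δ ω : ℝ} {j : ℕ} (hω : 0 < ω)
    (h : IsEquidistributed lam δ ω j) (τ : Fin j → ℝ) :
    δ * n ≤ (Set.ncard {k : Fin n | ω ^ j ≤ ∏ l, |lam k - τ l|} : ℝ) := by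
  classical
  -- For small `ε > 0` this perturbation makes the points distinct, so they form a finite set of
  -- exactly `j` elements to which the hypothesis applies.
  set σ : ℝ → Fin j → ℝ := fun ε l => τ l + ε * ((l : ℕ) : ℝ) with hσ
  have hσ0 : ∀ l, Filter.Tendsto (fun ε => σ ε l) (nhdsWithin 0 (Set.Ioi 0)) (nhds (τ l)) := by
    intro l
    have hc : Continuous fun ε => σ ε l := by fun_prop
    have := (hc.tendsto 0).mono_left (nhdsWithin_le_nhds (s := Set.Ioi 0))
    simpa [hσ] using this
  have hinj : ∀ᶠ ε in nhdsWithin (0 : ℝ) (Set.Ioi 0), Function.Injective (σ ε) := by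
    have : ∀ l m : Fin j, l ≠ m → ∀ᶠ ε in nhdsWithin (0 : ℝ) (Set.Ioi 0), σ ε l ≠ σ ε m := by
      intro l m hlm
      by_cases hτ : τ l = τ m
      · filter_upwards [self_mem_nhdsWithin] with ε hε heq
        simp only [hσ, hτ, add_right_inj] at heq
        have := mul_left_cancel₀ (ne_of_gt hε) heq
        exact hlm (Fin.ext (by exact_mod_cast this))
      · filter_upwards [((hσ0 l).sub (hσ0 m)).eventually_ne (sub_ne_zero.2 hτ)] with ε hε
        exact sub_ne_zero.1 hε
    have hall := Filter.eventually_all.2 fun l => Filter.eventually_all.2 fun m =>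
      Filter.eventually_all.2 fun hlm : l ≠ m => this l m hlm
    filter_upwards [hall] with ε hε l m hlm
    by_contra hne
    exact hε l m hne hlm
  -- Strict failure of the lower bound is an open condition, so for small `ε` every index good for
  -- the perturbed points is good for the original ones.
  have hsmall : ∀ᶠ ε in nhdsWithin (0 : ℝ) (Set.Ioi 0), ∀ k : Fin n,
      ∏ l, |lam k - τ l| < ω ^ j → ∏ l, |lam k - σ ε l| < ω ^ j := by
    refine Filter.eventually_all.2 fun k => ?_
    by_cases hk : ∏ l, |lam k - τ l| < ω ^ j
    · have : Filter.Tendsto (fun ε => ∏ l, |lam k - σ ε l|) (nhdsWithin 0 (Set.Ioi 0))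
          (nhds (∏ l, |lam k - τ l|)) :=
        tendsto_finsetProd _ fun l _ => ((hσ0 l).const_sub _).abs
      filter_upwards [this.eventually_lt_const hk] with ε hε _ using hε
    · exact Filter.Eventually.of_forall fun _ h => absurd h hk
  obtain ⟨ε, hε, hεs⟩ := (hinj.and hsmall).exists
  have hcard : (Finset.univ.image (σ ε)).card = j := by
    rw [Finset.card_image_of_injective _ hε, Finset.card_univ, Fintype.card_fin]
  refine (h (Finset.univ.image (σ ε)) hcard.le).trans ?_
  rw [hcard]
  norm_cast
  refine Set.ncard_le_ncard ?_ (Set.toFinite _)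
  rintro k ⟨hk, hlog⟩
  by_contra hcon
  have h1 := hεs k (not_le.1 hcon)
  have hpos : ∀ l, 0 < |lam k - σ ε l| := fun l =>
    abs_pos.2 (sub_ne_zero.2 fun h => hk (Finset.mem_image.2 ⟨l, Finset.mem_univ _, h.symm⟩))
  rw [Finset.sum_image fun _ _ _ _ h => hε h, ← Real.log_prod fun l _ => (hpos l).ne',
    ← Real.log_pow] at hlog
  exact absurd ((Real.log_le_log_iff (by positivity)
    (Finset.prod_pos fun l _ => hpos l)).1 hlog) (not_le.2 h1)

end Rounding

/-! ### A lower bound for the residual outside a small exceptional set. -/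

section GoodEvent

variable {n : ℕ}

/-- The indices `k` at which the monic polynomial with the rounding points `r` as roots is at least
`ω ^ i` in absolute value. -/
noncomputable def largeIndices (lam : Fin n → ℝ) (ω : ℝ) {i : ℕ}
    (r : Fin i → Fin n × Fin n × Bool) : Finset (Fin n) :=
  open scoped Classical in
  Finset.univ.filter fun k => ω ^ i ≤ ∏ l, |lam k - roundingPoint lam (r l)|

theorem IsEquidistributed.le_card_largeIndices {lam : Fin n → ℝ} {δ ω : ℝ} {i : ℕ} (hω : 0 < ω)
    (h : IsEquidistributed lam δ ω i) (r : Fin i → Fin n × Fin n × Bool) :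
    δ * n ≤ (largeIndices lam ω r).card := by
  have := h.le_ncard_prod hω fun l => roundingPoint lam (r l)
  rwa [← Set.ncard_coe_finset, largeIndices, Finset.coe_filter_univ]

/-- The tuple `r` rounds the Ritz values of `u`. On `largeIndices` the rounded polynomial is at
least `ω ^ i` in absolute value, so the true one is at least `(4/5 ω) ^ i`. Only finitely many `r`
occur, whatever `u` is. -/
theorem exists_le_norm_krylovResidual_sq [NeZero n] {A : Matrix (Fin n) (Fin n) ℂ}
    (hA : A.IsHermitian) {ω : ℝ} (hω : 0 < ω) (i : ℕ) (u : EuclideanSpace ℂ (Fin n)) :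
    ∃ r : Fin i → Fin n × Fin n × Bool, ((4 / 5 * ω) ^ i) ^ 2 *
      ∑ k ∈ largeIndices hA.eigenvalues ω r, ‖inner ℂ (hA.eigenvectorBasis k) u‖ ^ 2 ≤
      ‖krylovResidual (Matrix.toEuclideanCLM (n := Fin n) (𝕜 := ℂ) A) u i‖ ^ 2 := by
  obtain ⟨t, hti, -, ht⟩ := exists_monicOfRoots_aeval_eq_krylovResidual
    (toEuclideanCLM_inner_symm hA) le_rfl u i
  obtain ⟨L, rfl⟩ := Quot.exists_rep t
  change L.length = i at hti
  subst hti
  choose c hc using exists_roundingPoint hA.eigenvalues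
  refine ⟨fun l => c (L.get l), ?_⟩
  rw [← ht, norm_aeval_apply_sq, Finset.mul_sum]
  refine le_trans (Finset.sum_le_sum fun k hk => ?_)
    (Finset.sum_le_univ_sum_of_nonneg fun k => by positivity)
  refine mul_le_mul_of_nonneg_right ?_ (by positivity)
  rw [← sq_abs (Polynomial.eval _ _)]
  refine pow_le_pow_left₀ (by positivity) ?_ 2
  have hk' : ω ^ L.length ≤ ∏ l, |hA.eigenvalues k - roundingPoint hA.eigenvalues (c (L.get l))| := by
    simpa [largeIndices] using hk
  have heval : |(monicOfRoots (Quot.mk _ L)).eval (hA.eigenvalues k)| =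
      ∏ l, |hA.eigenvalues k - L.get l| := by
    change |(monicOfRoots (L : Multiset ℝ)).eval (hA.eigenvalues k)| = _
    rw [eval_monicOfRoots, Multiset.map_coe, Multiset.prod_coe, ← Finset.abs_prod]
    congr 1
    exact (Fin.prod_univ_fun_getElem L fun c => hA.eigenvalues k - c).symm
  rw [heval]
  have hprod : ∏ l, |hA.eigenvalues k - roundingPoint hA.eigenvalues (c (L.get l))| ≤
      ∏ l, (5 / 4 * |hA.eigenvalues k - L.get l|) :=
    Finset.prod_le_prod (fun _ _ => abs_nonneg _) fun l _ => hc _ k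
  rw [Finset.prod_mul_distrib, Finset.prod_const, Finset.card_univ, Fintype.card_fin] at hprod
  calc (4 / 5 * ω) ^ L.length = (4 / 5) ^ L.length * ω ^ L.length := mul_pow _ _ _
    _ ≤ (4 / 5) ^ L.length * ((5 / 4) ^ L.length * ∏ l, |hA.eigenvalues k - L.get l|) := by
        gcongr; exact hk'.trans hprod
    _ = _ := by rw [← mul_assoc, ← mul_pow]; norm_num

theorem complexify_sub (u w : EuclideanSpace ℝ (Fin n)) :
    complexify u - complexify w = complexify (u - w) := by
  ext k; simp [complexify]

theorem norm_complexify (u : EuclideanSpace ℝ (Fin n)) : ‖complexify u‖ = ‖u‖ := by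
  simp [complexify, EuclideanSpace.norm_eq]

/-- The square root of the mass on `S` is the norm of an orthogonal projection, hence `1`-Lipschitz,
and its second moment is `|S| / n ≥ δ`. -/
theorem sphereUniform_real_sum_lt_le (hn : n ≠ 0)
    (e : OrthonormalBasis (Fin n) ℂ (EuclideanSpace ℂ (Fin n))) {δ : ℝ} (hδ : 0 < δ)
    {S : Finset (Fin n)} (hS : δ * n ≤ S.card) :
    (sphereUniform n).real {u | ∑ k ∈ S, ‖inner ℂ (e k) (complexify u.1)‖ ^ 2 < 4 / 9 * δ} ≤
      7 / δ * Real.exp (-(n * δ / 64)) := by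
  have := isProbabilityMeasure_sphereUniform hn
  have hn0 : (0 : ℝ) < n := by exact_mod_cast Nat.pos_of_ne_zero hn
  set y : EuclideanSpace ℂ (Fin n) → EuclideanSpace ℂ S :=
    fun x => WithLp.toLp 2 fun k => inner ℂ (e k) x with hy
  have hysq : ∀ x, ‖y x‖ ^ 2 = ∑ k ∈ S, ‖inner ℂ (e k) x‖ ^ 2 := by
    intro x
    rw [EuclideanSpace.norm_sq_eq]
    exact Finset.sum_coe_sort S fun k => ‖inner ℂ (e k) x‖ ^ 2
  have hyle : ∀ x, ‖y x‖ ≤ ‖x‖ := by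
    intro x
    refine (sq_le_sq₀ (norm_nonneg _) (norm_nonneg _)).1 ?_
    rw [hysq, ← e.sum_sq_norm_inner_right x]
    exact Finset.sum_le_univ_sum_of_nonneg fun k => by positivity
  have hysub : ∀ x z, y x - y z = y (x - z) := by
    intro x z; ext k; simp [hy]
  have hLip : LipschitzWith 1 fun u : UnitSphere n => ‖y (complexify u.1)‖ := by
    refine LipschitzWith.of_dist_le_mul fun u w => ?_
    rw [NNReal.coe_one, one_mul, Real.dist_eq, Subtype.dist_eq, dist_eq_norm, ← norm_complexify,
      ← complexify_sub]
    refine (abs_norm_sub_norm_le _ _).trans ?_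
    rw [hysub]
    exact hyle _
  have hint : ∀ k, Integrable (fun u : UnitSphere n => ‖inner ℂ (e k) (complexify u.1)‖ ^ 2)
      (sphereUniform n) := by
    intro k
    simp only [norm_inner_complexify_sq]
    exact (integrable_inner_sq hn _).add (integrable_inner_sq hn _)
  have hmom : δ ≤ ∫ u : UnitSphere n, ‖y (complexify u.1)‖ ^ 2 ∂(sphereUniform n) := by
    simp only [hysq]
    rw [integral_finsetSum _ fun k _ => hint k,
      Finset.sum_congr rfl fun k _ => integral_norm_inner_sq hn (e.norm_eq_one k),
      Finset.sum_const, nsmul_eq_mul, mul_one_div, le_div_iff₀ hn0]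
    exact hS
  refine le_trans (measureReal_mono ?_) (sphereUniform_real_lt_le hn hLip
    (fun u => norm_nonneg _) (fun u => (hyle _).trans (by simp [norm_complexify])) hδ hmom)
  intro u hu
  rw [Set.mem_ofPred_eq, ← hysq] at hu
  rw [Set.mem_ofPred_eq]
  refine lt_of_pow_lt_pow_left₀ 2 (by positivity) ?_
  rw [mul_pow, Real.sq_sqrt hδ.le]
  linarith

/-- The start vectors that put mass at least `4 δ / 9` on each of the sets `largeIndices`. -/
def spreadVectors {A : Matrix (Fin n) (Fin n) ℂ} (hA : A.IsHermitian) (δ ω : ℝ) (i : ℕ) :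
    Set (UnitSphere n) :=
  {u | ∀ r : Fin i → Fin n × Fin n × Bool, 4 / 9 * δ ≤
    ∑ k ∈ largeIndices hA.eigenvalues ω r, ‖inner ℂ (hA.eigenvectorBasis k) (complexify u.1)‖ ^ 2}

theorem le_norm_krylovResidual_of_mem_spreadVectors [NeZero n] {A : Matrix (Fin n) (Fin n) ℂ}
    {hA : A.IsHermitian} {δ ω : ℝ} (hδ : 0 < δ) (hω : 0 < ω) {i : ℕ} {u : UnitSphere n}
    (hu : u ∈ spreadVectors hA δ ω i) : (4 / 5 * ω) ^ i * (2 / 3 * √δ) ≤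
      ‖krylovResidual (Matrix.toEuclideanCLM (n := Fin n) (𝕜 := ℂ) A) (complexify u.1) i‖ := by
  obtain ⟨r, hr⟩ := exists_le_norm_krylovResidual_sq hA hω i (complexify u.1)
  refine (sq_le_sq₀ (by positivity) (norm_nonneg _)).1 (le_trans ?_ hr)
  rw [mul_pow, mul_pow (2 / 3 : ℝ), Real.sq_sqrt hδ.le]
  have := hu r
  gcongr
  linarith

theorem sphereUniform_real_compl_spreadVectors_le (hn : n ≠ 0) {A : Matrix (Fin n) (Fin n) ℂ}
    (hA : A.IsHermitian) {δ ω : ℝ} (hδ : 0 < δ) (hω : 0 < ω) {i : ℕ}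
    (h : IsEquidistributed hA.eigenvalues δ ω i) :
    (sphereUniform n).real (spreadVectors hA δ ω i)ᶜ ≤
      (2 * (n : ℝ) ^ 2) ^ i * (7 / δ * Real.exp (-(n * δ / 64))) := by
  have := isProbabilityMeasure_sphereUniform hn
  have hsub : (spreadVectors hA δ ω i)ᶜ ⊆ ⋃ r : Fin i → Fin n × Fin n × Bool,
      {u : UnitSphere n | ∑ k ∈ largeIndices hA.eigenvalues ω r,
        ‖inner ℂ (hA.eigenvectorBasis k) (complexify u.1)‖ ^ 2 < 4 / 9 * δ} := by
    intro u hu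
    simpa [spreadVectors] using hu
  refine (measureReal_mono hsub).trans ((measureReal_iUnion_fintype_le _).trans ?_)
  refine (Finset.sum_le_sum fun r _ => sphereUniform_real_sum_lt_le hn hA.eigenvectorBasis hδ
    (h.le_card_largeIndices hω r)).trans (le_of_eq ?_)
  rw [Finset.sum_const, nsmul_eq_mul, Finset.card_univ]
  congr 1
  simp
  ring

end GoodEvent

/-! ### Numerical estimates absorbing the union bound. -/

theorem three_mul_log_add_le {x : ℝ} (hx : 55000 ≤ x) : 3 * Real.log x + 7 / 10 ≤ 198 / 1000 * √x := by
  have hlog2 := Real.log_two_lt_d9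
  have h0 : Real.exp 2 ≤ 2 ^ 15 := by
    have h1 : Real.exp 2 = Real.exp 1 ^ 2 := by rw [← Real.exp_nat_mul]; norm_num
    rw [h1]
    have := Real.exp_one_lt_d9
    have h2 : Real.exp 1 ^ 2 ≤ 3 ^ 2 := by gcongr; linarith
    linarith
  -- `log x / √x` decreases beyond `e²`; it is evaluated at `2 ^ 15`, where the logarithm is
  -- explicit.
  have hanti := Real.log_div_sqrt_antitoneOn (Set.mem_Ici.2 h0)
    (Set.mem_Ici.2 (h0.trans (by linarith : (2 : ℝ) ^ 15 ≤ x))) (by linarith : (2 : ℝ) ^ 15 ≤ x)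
  have hs1 : (181 : ℝ) ≤ √(2 ^ 15) := Real.le_sqrt_of_sq_le (by norm_num)
  have hs2 : (234 : ℝ) ≤ √x := Real.le_sqrt_of_sq_le (by linarith)
  have h3 : Real.log (2 ^ 15) / √(2 ^ 15) ≤ 10.398 / 181 := by
    rw [Real.log_pow]
    push_cast
    have : 15 * Real.log 2 ≤ 10.398 := by linarith
    gcongr
  have h4 : Real.log x / √x ≤ 10.398 / 181 := hanti.trans h3
  rw [div_le_iff₀ (by linarith)] at h4
  linarith

/-- `hx` and `hF` say that the claimed bound is not trivial. They force `n ≥ 55000` and `δ² n ≥ 11 ·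
16 ^ i`, hence `n δ ≥ 13.2 i √n`, which dominates the logarithm of the number of tuples, of order `i
log n`. -/
theorem spreadVectors_error_le {n i : ℕ} (hi : 1 ≤ i) {δ : ℝ} (hδ : 0 < δ)
    (hx : Real.log 2 < 1 / 16 * (1 / 16) ^ i * δ ^ 2 * n)
    (hF : Real.log 2 < (min δ (1 / 50)) ^ 2 / 32 * n) :
    (2 * (n : ℝ) ^ 2) ^ i * (7 / δ * Real.exp (-(n * δ / 64))) ≤
      Real.exp (-((min δ (1 / 50)) ^ 2 / 32 * n)) := by
  have hlog2 := Real.log_two_gt_d9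
  have hlog2' := Real.log_two_lt_d9
  set m := min δ (1 / 50) with hm
  have hm0 : 0 < m := lt_min hδ (by norm_num)
  have hmδ : m ≤ δ := min_le_left _ _
  have hm50 : m ≤ 1 / 50 := min_le_right _ _
  have hn0 : (0 : ℝ) ≤ n := Nat.cast_nonneg n
  have hn : (55000 : ℝ) ≤ n := by
    have : m ^ 2 ≤ (1 / 50) ^ 2 := by gcongr
    nlinarith
  have hnpos : (0 : ℝ) < n := by linarith
  have h16 : 11 * 16 ^ i ≤ δ ^ 2 * n := by
    have h1 : (1 / 16 : ℝ) ^ i * 16 ^ i = 1 := by rw [← mul_pow]; norm_num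
    have h2 : (0 : ℝ) < 16 ^ i := by positivity
    have h3 : 11 ≤ (1 / 16) ^ i * (δ ^ 2 * n) := by nlinarith
    calc (11 : ℝ) * 16 ^ i ≤ (1 / 16) ^ i * (δ ^ 2 * n) * 16 ^ i := by gcongr
      _ = ((1 / 16 : ℝ) ^ i * 16 ^ i) * (δ ^ 2 * n) := by ring
      _ = _ := by rw [h1, one_mul]
  have h4i : (4 * i : ℝ) ≤ 4 ^ i := by
    have h1 : i ≤ 4 ^ (i - 1) := by
      have := Nat.lt_pow_self (n := i - 1) (a := 4) (by norm_num)
      omega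
    have h2 : 4 ^ i = 4 * 4 ^ (i - 1) := by
      rw [← pow_succ', Nat.sub_add_cancel hi]
    have h3 : 4 * i ≤ 4 ^ i := by omega
    exact_mod_cast h3
  have hnδ : 13.2 * i * √n ≤ n * δ := by
    refine (sq_le_sq₀ (by positivity) (by positivity)).1 ?_
    have h1 : (16 : ℝ) ^ i = (4 ^ i) ^ 2 := by rw [← pow_mul, mul_comm, pow_mul]; norm_num
    have h2 : (4 * i : ℝ) ^ 2 ≤ (4 ^ i) ^ 2 := by gcongr
    rw [mul_pow, Real.sq_sqrt hn0]
    have h3 : (13.2 * i : ℝ) ^ 2 ≤ δ ^ 2 * n := by nlinarith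
    calc _ ≤ δ ^ 2 * n * n := by gcongr
      _ = _ := by ring
  have hi1 : (1 : ℝ) ≤ i := by exact_mod_cast hi
  have hsqrt : (234 : ℝ) ≤ √n := Real.le_sqrt_of_sq_le (by linarith)
  have h7 : 7 / δ ≤ n := by
    rw [div_le_iff₀ hδ]
    nlinarith
  have hlogn : 0 ≤ Real.log n := Real.log_nonneg (by linarith)
  -- The constants fit since `0.198 = 13.2 · 3/200`.
  have hmain : (2 * (n : ℝ) ^ 2) ^ i * (7 / δ) ≤ Real.exp (3 / 200 * (n * δ)) := by
    have h1 : (2 * (n : ℝ) ^ 2) ^ i * n = Real.exp (i * (Real.log 2 + 2 * Real.log n) + Real.log n) := by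
      rw [Real.exp_add, Real.exp_log hnpos, Real.exp_nat_mul, Real.exp_add, Real.exp_log two_pos,
        mul_comm (2 : ℝ) (Real.log n), Real.exp_mul, Real.exp_log hnpos]
      norm_num
    calc (2 * (n : ℝ) ^ 2) ^ i * (7 / δ) ≤ (2 * (n : ℝ) ^ 2) ^ i * n := by gcongr
      _ = _ := h1
      _ ≤ _ := by
        refine Real.exp_le_exp.2 ?_
        have h2 := three_mul_log_add_le hn
        have h3 : Real.log n ≤ i * Real.log n := le_mul_of_one_le_left hlogn hi1
        have h4 : (i : ℝ) * (3 * Real.log n + 7 / 10) ≤ i * (198 / 1000 * √n) := by gcongr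
        nlinarith
  rw [← mul_assoc]
  refine (mul_le_mul_of_nonneg_right hmain (Real.exp_pos _).le).trans ?_
  rw [← Real.exp_add]
  refine Real.exp_le_exp.2 ?_
  -- The remaining exponent is `1/64 - 3/200 = 1/1600 = 1/(32 · 50)` times `n δ`; the cap `1/50` is
  -- chosen to match.
  have : m ^ 2 ≤ δ / 50 := by nlinarith
  nlinarith

/-! ### Concentration about the median and assembly. -/

/-- A function that is Lipschitz on a large part of the sphere concentrates about its median. -/
theorem sphereUniform_real_lt_abs_sub_median_le {n : ℕ} (hn : n ≠ 0) {f : UnitSphere n → ℝ}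
    {a : ℝ} (ha : IsMedian (sphereUniform n) f a) {s : Set (UnitSphere n)} {C : ℝ} (hC : 0 < C)
    (hf : ∀ u ∈ s, ∀ w ∈ s, |f u - f w| ≤ C * dist u w) {ε E F : ℝ} (hε : 0 ≤ ε) (hE0 : 0 < E)
    (hE : Real.exp (-(n * (ε / C) ^ 2 / 4)) ≤ E ^ 2) (hF : (sphereUniform n).real sᶜ ≤ F) :
    (sphereUniform n).real {u | ε < |f u - a|} ≤ 2 * F + 2 * E := by
  have := isProbabilityMeasure_sphereUniform hn
  set σ := sphereUniform n
  have hη0 : 0 ≤ σ.real sᶜ := measureReal_nonneg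
  -- In the first case `2 F + 2 E ≥ 1` and the bound is trivial. Otherwise each half-space of the
  -- median keeps measure more than `E` inside `s`, and a product bound `E ^ 2` leaves at most `E`
  -- for the opposite tail.
  rcases le_or_gt (1 / 2 - σ.real sᶜ) E with hlt | hlt
  · have : σ.real {u | ε < |f u - a|} ≤ 1 := measureReal_le_one
    linarith
  have hhalf : ∀ t : Set (UnitSphere n), 1 / 2 ≤ σ.real t → 1 / 2 - σ.real sᶜ ≤ σ.real (t ∩ s) := by
    intro t ht
    have h1 : t ⊆ (t ∩ s) ∪ sᶜ := fun u hu => by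
      by_cases hus : u ∈ s
      · exact Or.inl ⟨hu, hus⟩
      · exact Or.inr hus
    have h2 := (measureReal_mono (μ := σ) h1).trans (measureReal_union_le _ _)
    linarith
  have hside : ∀ t t' : Set (UnitSphere n), 1 / 2 ≤ σ.real t →
      (∀ u ∈ t, ∀ w ∈ t', ε ≤ |f u - f w|) → σ.real (t' ∩ s) ≤ E := by
    intro t t' ht htt'
    have h1 := sphereUniform_real_mul_le hn (s := t ∩ s) (t := t' ∩ s) (ρ := ε / C)
      (by positivity) (by
        rintro u ⟨hut, hus⟩ w ⟨hwt, hws⟩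
        rw [div_le_iff₀ hC, mul_comm]
        exact (htt' u hut w hwt).trans (hf u hus w hws))
    have h2 : E * σ.real (t' ∩ s) ≤ E * E := by
      rw [← sq]
      refine le_trans ?_ (h1.trans hE)
      exact mul_le_mul_of_nonneg_right (hlt.le.trans (hhalf t ht)) measureReal_nonneg
    exact le_of_mul_le_mul_left h2 hE0
  have hup := hside {u | f u ≤ a} {u | a + ε < f u} ha.1 fun u hu w hw => by
    rw [Set.mem_ofPred_eq] at hu hw
    rw [abs_sub_comm]
    exact le_trans (by linarith) (le_abs_self _)
  have hdown := hside {u | a ≤ f u} {u | f u < a - ε} ha.2 fun u hu w hw => by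
    rw [Set.mem_ofPred_eq] at hu hw
    exact le_trans (by linarith) (le_abs_self _)
  have hcover : {u | ε < |f u - a|} ⊆
      (({u | a + ε < f u} ∩ s) ∪ ({u | f u < a - ε} ∩ s)) ∪ sᶜ := by
    intro u hu
    by_cases hus : u ∈ s
    · rcases lt_abs.1 (show ε < |f u - a| from hu) with h | h
      · exact Or.inl (Or.inl ⟨by rw [Set.mem_ofPred_eq]; linarith, hus⟩)
      · exact Or.inl (Or.inr ⟨by rw [Set.mem_ofPred_eq]; linarith, hus⟩)
    · exact Or.inr hus
  have h1 := (measureReal_mono (μ := σ) hcover).trans ((measureReal_union_le _ _).trans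
    (add_le_add_left (measureReal_union_le _ _) _))
  linarith

theorem IsMedian.abs_le {Ω : Type*} [MeasurableSpace Ω] {P : Measure Ω} {X : Ω → ℝ} {m M : ℝ}
    (hm : IsMedian P X m) (hX : ∀ x, |X x| ≤ M) : |m| ≤ M := by
  have hne : ∀ s : Set Ω, 1 / 2 ≤ P.real s → s.Nonempty := by
    intro s hs
    by_contra hcon
    rw [Set.not_nonempty_iff_eq_empty.1 hcon, measureReal_empty] at hs
    norm_num at hs
  obtain ⟨x, hx⟩ := hne _ hm.1
  obtain ⟨y, hy⟩ := hne _ hm.2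
  rw [Set.mem_ofPred_eq] at hx hy
  exact _root_.abs_le.2 ⟨(_root_.abs_le.1 (hX x)).1.trans hx, hy.trans (_root_.abs_le.1 (hX y)).2⟩

/-- Concentration for a function of the start vector whose Lipschitz constant is controlled by the
norm of the Krylov residual of order `i`. -/
theorem sphereUniform_real_lt_abs_sub_median_le_of_residual {n : ℕ} (hn : n ≠ 0)
    {A : Matrix (Fin n) (Fin n) ℂ} (hA : A.IsHermitian) {δ ω : ℝ} (hδ : 0 < δ) (hω : 0 < ω)
    {i : ℕ} (hequi : IsEquidistributed hA.eigenvalues δ ω i) {f : UnitSphere n → ℝ}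
    (hfM : ∀ u, |f u| ≤ matrixOpNorm A)
    (hf0 : i = 0 → ∀ u w, |f u - f w| ≤ 2 * matrixOpNorm A * dist u w)
    (hf : ∀ κ : ℝ, 0 < κ → ∀ u w : UnitSphere n,
      κ ≤ ‖krylovResidual (Matrix.toEuclideanCLM (n := Fin n) (𝕜 := ℂ) A) (complexify u.1) i‖ →
      κ ≤ ‖krylovResidual (Matrix.toEuclideanCLM (n := Fin n) (𝕜 := ℂ) A) (complexify w.1) i‖ →
      |f u - f w| ≤ 3 * matrixOpNorm A * (2 * matrixOpNorm A) ^ i / κ * dist u w)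
    {a : ℝ} (ha : IsMedian (sphereUniform n) f a) {t : ℝ} (ht : 0 < t) :
    (sphereUniform n).real {u | t * matrixOpNorm A < |f u - a|} ≤
      2 * Real.exp (-((min δ (1 / 50)) ^ 2 / 32 * n)) +
      2 * Real.exp (-(1 / 64 * (ω / (4 * matrixOpNorm A)) ^ (2 * i) * δ ^ 2 * t ^ 2 * n)) := by
  have := isProbabilityMeasure_sphereUniform hn
  have : NeZero n := ⟨hn⟩
  have hn0 : (0 : ℝ) < n := by exact_mod_cast Nat.pos_of_ne_zero hn
  set M := matrixOpNorm A with hMdef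
  have hM0 : 0 ≤ M := norm_nonneg _
  set F := Real.exp (-((min δ (1 / 50)) ^ 2 / 32 * n)) with hF
  set E := Real.exp (-(1 / 64 * (ω / (4 * M)) ^ (2 * i) * δ ^ 2 * t ^ 2 * n)) with hE
  have hF0 : 0 < F := Real.exp_pos _
  have hE0 : 0 < E := Real.exp_pos _
  have haM := ha.abs_le hfM
  -- Both `f` and its median are bounded by `M`, so the event is empty when `t ≥ 2` or `M = 0`.
  by_cases htriv : 2 * M ≤ t * M
  · have hempty : {u | t * M < |f u - a|} = ∅ := by
      ext u
      simp only [Set.mem_ofPred_eq, Set.mem_empty_iff_false, iff_false, not_lt]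
      refine le_trans (abs_sub _ _) ?_
      linarith [hfM u]
    rw [hempty, measureReal_empty]
    positivity
  rw [not_le] at htriv
  have hM : 0 < M := by
    rcases hM0.eq_or_lt with h | h
    · rw [← h] at htriv; simp at htriv
    · exact h
  have ht2 : t < 2 := lt_of_mul_lt_mul_right htriv hM0
  have hδ1 : δ ≤ 1 := by
    have h1 := hequi ∅ (by simp)
    have h2 : (Set.ncard {k : Fin n | hA.eigenvalues k ∉ (∅ : Finset ℝ) ∧
        ((∅ : Finset ℝ).card : ℝ) * Real.log ω ≤
          ∑ t ∈ (∅ : Finset ℝ), Real.log |hA.eigenvalues k - t|} : ℝ) ≤ n := by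
      have := Set.ncard_le_card {k : Fin n | hA.eigenvalues k ∉ (∅ : Finset ℝ) ∧
        ((∅ : Finset ℝ).card : ℝ) * Real.log ω ≤
          ∑ t ∈ (∅ : Finset ℝ), Real.log |hA.eigenvalues k - t|}
      rw [Nat.card_eq_fintype_card, Fintype.card_fin] at this
      exact_mod_cast this
    exact le_of_mul_le_mul_right (by linarith) hn0
  have hE2 : E ^ 2 =
      Real.exp (-(1 / 32 * (ω / (4 * M)) ^ (2 * i) * δ ^ 2 * t ^ 2 * n)) := by
    rw [hE, ← Real.exp_nat_mul]; congr 1; push_cast; ring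
  rcases Nat.eq_zero_or_pos i with hi | hi
  -- For `i = 0` the function is Lipschitz everywhere and there is no exceptional set.
  · refine sphereUniform_real_lt_abs_sub_median_le hn ha (s := Set.univ) (C := 2 * M)
      (by positivity) (fun u _ w _ => hf0 hi u w) (by positivity) hE0 ?_ (by simpa using hF0.le)
    rw [hE2, hi]
    refine Real.exp_le_exp.2 (neg_le_neg ?_)
    have h1 : t * M / (2 * M) = t / 2 := by field_simp
    rw [h1]
    have h2 : δ ^ 2 ≤ 1 := pow_le_one₀ hδ.le hδ1
    have h3 : δ ^ 2 * (t ^ 2 * n) ≤ 1 * (t ^ 2 * n) := by gcongr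
    nlinarith [show 0 ≤ t ^ 2 * n by positivity]
  -- Past these two trivial cases both exponents exceed `log 2`, which is what
  -- `spreadVectors_error_le` requires.
  by_cases hEh : 1 / 2 ≤ E
  · have : (sphereUniform n).real {u | t * M < |f u - a|} ≤ 1 := measureReal_le_one
    linarith
  by_cases hFh : 1 / 2 ≤ F
  · have : (sphereUniform n).real {u | t * M < |f u - a|} ≤ 1 := measureReal_le_one
    linarith
  have hhalf : ∀ x : ℝ, ¬ 1 / 2 ≤ Real.exp (-x) → Real.log 2 < x := by
    intro x hx
    have h1 : Real.exp (-x) < Real.exp (-Real.log 2) := by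
      rw [Real.exp_neg (Real.log 2), Real.exp_log two_pos, ← one_div]; exact not_le.1 hx
    linarith [Real.exp_lt_exp.1 h1]
  -- The one-point set `{0}` yields an eigenvalue of absolute value at least `ω`.
  have hωM : ω ≤ M := by
    have h1 := hequi {0} (by simpa using Nat.succ_le_of_lt hi)
    have h2 : {k : Fin n | hA.eigenvalues k ∉ ({0} : Finset ℝ) ∧
        (({0} : Finset ℝ).card : ℝ) * Real.log ω ≤
          ∑ t ∈ ({0} : Finset ℝ), Real.log |hA.eigenvalues k - t|}.Nonempty := by
      rw [Set.nonempty_iff_ne_empty]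
      intro hcon
      rw [hcon, Set.ncard_empty] at h1
      have : 0 < δ * n := by positivity
      push_cast at h1
      linarith
    obtain ⟨k, hk0, hk⟩ := h2
    simp only [Finset.mem_singleton, Finset.card_singleton, Nat.cast_one, one_mul,
      Finset.sum_singleton, sub_zero] at hk0 hk
    exact ((Real.log_le_log_iff hω (abs_pos.2 hk0)).1 hk).trans (abs_eigenvalues_le hA k)
  have hx : Real.log 2 < 1 / 16 * (1 / 16) ^ i * δ ^ 2 * n := by
    refine (hhalf _ hEh).trans_le ?_
    have h1 : (ω / (4 * M)) ^ (2 * i) ≤ (1 / 16) ^ i := by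
      rw [pow_mul]
      have h2 : ω / (4 * M) ≤ 1 / 4 := by
        rw [div_le_iff₀ (by positivity)]; linarith
      have h3 : (ω / (4 * M)) ^ 2 ≤ (1 / 4) ^ 2 := by gcongr
      exact pow_le_pow_left₀ (by positivity) (h3.trans (by norm_num)) _
    have h4 : t ^ 2 ≤ 2 ^ 2 := by gcongr
    calc _ ≤ 1 / 64 * (1 / 16) ^ i * δ ^ 2 * 2 ^ 2 * n := by gcongr
      _ = _ := by ring
  set κ := (4 / 5 * ω) ^ i * (2 / 3 * √δ) with hκ
  have hκ0 : 0 < κ := by positivity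
  refine sphereUniform_real_lt_abs_sub_median_le hn ha (s := spreadVectors hA δ ω i)
    (C := 3 * M * (2 * M) ^ i / κ) (by positivity) (fun u hu w hw => hf κ hκ0 u w
      (le_norm_krylovResidual_of_mem_spreadVectors hδ hω hu)
      (le_norm_krylovResidual_of_mem_spreadVectors hδ hω hw)) (by positivity) hE0 ?_
    ((sphereUniform_real_compl_spreadVectors_le hn hA hδ hω hequi).trans
      (spreadVectors_error_le hi hδ hx (hhalf _ hFh)))
  rw [hE2]
  refine Real.exp_le_exp.2 (neg_le_neg ?_)
  have hsq : (t * M / (3 * M * (2 * M) ^ i / κ)) ^ 2 =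
      t ^ 2 * δ * (4 / 81) * ((4 / 25) ^ i * (ω / M) ^ (2 * i)) := by
    have h1 : t * M / (3 * M * (2 * M) ^ i / κ) = t * (2 / 9 * √δ) * (2 / 5 * (ω / M)) ^ i := by
      have h2 : (2 / 5 * (ω / M)) ^ i = (4 / 5 * ω) ^ i / (2 * M) ^ i := by
        rw [← div_pow]; congr 1; field_simp; norm_num
      rw [h2, hκ]
      field_simp
      norm_num
    rw [h1, mul_pow, mul_pow, mul_pow (2 / 9 : ℝ), Real.sq_sqrt hδ.le, ← pow_mul, mul_comm i 2,
      mul_pow (2 / 5 : ℝ), pow_mul (2 / 5 : ℝ),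
      show (2 / 5 : ℝ) ^ 2 = 4 / 25 by norm_num]
    ring
  have h4 : (ω / (4 * M)) ^ (2 * i) = (1 / 16) ^ i * (ω / M) ^ (2 * i) := by
    have : ω / (4 * M) = 1 / 4 * (ω / M) := by field_simp
    rw [this, mul_pow, pow_mul (1 / 4 : ℝ)]
    norm_num
  rw [hsq, h4]
  set y := (ω / M) ^ (2 * i)
  have hy : 0 ≤ y := by positivity
  -- Here `4/25 = (4/5 · 1/2)²` combines the rounding loss with the Lipschitz constant. The
  -- inequality amounts to `81/32 ≤ (64/25) ^ i`, which is nearly sharp at `i = 1` and decides how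
  -- fine the rounding must be.
  have hpow : 81 / 32 * (1 / 16 : ℝ) ^ i ≤ (4 / 25) ^ i := by
    have h5 : (4 / 25 : ℝ) ^ i = (64 / 25) ^ i * (1 / 16) ^ i := by
      rw [← mul_pow]; norm_num
    rw [h5]
    gcongr
    exact le_trans (by norm_num) (le_self_pow₀ (by norm_num : (1 : ℝ) ≤ 64 / 25) (by omega))
  have hδ2 : δ ^ 2 ≤ δ := by nlinarith
  calc 1 / 32 * ((1 / 16) ^ i * y) * δ ^ 2 * t ^ 2 * n
      ≤ 1 / 32 * ((1 / 16) ^ i * y) * δ * t ^ 2 * n := by gcongr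
    _ = 81 / 32 * (1 / 16) ^ i * (y * δ * t ^ 2 * n / 81) := by ring
    _ ≤ (4 / 25) ^ i * (y * δ * t ^ 2 * n / 81) := by gcongr
    _ = _ := by ring

theorem theorem2p4 (n : ℕ) (A : Matrix (Fin n) (Fin n) ℂ) (hA : A.IsHermitian)
    (δ ω : ℝ) (hδ : 0 < δ) (hω : 0 < ω) (i : ℕ)
    (hequi : IsEquidistributed hA.eigenvalues δ ω i) :
    (∀ a : ℝ, IsMedian (sphereUniform n)
        (fun u : UnitSphere n => jacobiAlpha A i (complexify u.1)) a →
      ∀ t : ℝ, 0 < t →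
        (sphereUniform n).real {u : UnitSphere n |
            t * matrixOpNorm A < |jacobiAlpha A i (complexify u.1) - a|} ≤
          2 * Real.exp (-((min δ (1 / 50)) ^ 2 / 32 * n)) +
          2 * Real.exp
            (-(1 / 64 * (ω / (4 * matrixOpNorm A)) ^ (2 * i) * δ ^ 2 * t ^ 2 * n))) ∧
    (∀ b : ℝ, IsMedian (sphereUniform n)
        (fun u : UnitSphere n => jacobiBeta A i (complexify u.1)) b →
      ∀ t : ℝ, 0 < t →
        (sphereUniform n).real {u : UnitSphere n |
            t * matrixOpNorm A < |jacobiBeta A i (complexify u.1) - b|} ≤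
          2 * Real.exp (-((min δ (1 / 50)) ^ 2 / 32 * n)) +
          2 * Real.exp
            (-(1 / 64 * (ω / (4 * matrixOpNorm A)) ^ (2 * i) * δ ^ 2 * t ^ 2 * n))) := by
  rcases Nat.eq_zero_or_pos n with rfl | hn
  -- The sphere of `ℝ⁰` is empty and its measure is zero, not a probability measure.
  · refine ⟨fun a _ t _ => ?_, fun b _ t _ => ?_⟩ <;>
    · rw [sphereUniform_zero, measureReal_zero_apply]
      positivity
  have hu : ∀ u : UnitSphere n, ‖complexify u.1‖ = 1 := fun u => by simp [norm_complexify]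
  have hd : ∀ u w : UnitSphere n, ‖complexify u.1 - complexify w.1‖ = dist u w := fun u w => by
    rw [complexify_sub, norm_complexify, Subtype.dist_eq, dist_eq_norm]
  have hM : 0 ≤ matrixOpNorm A := norm_nonneg _
  refine ⟨fun a ha t ht => ?_, fun b hb t ht => ?_⟩
  · refine sphereUniform_real_lt_abs_sub_median_le_of_residual hn.ne' hA hδ hω hequi
      (fun u => abs_jacobiAlpha_le A (hu u) i) ?_ ?_ ha ht
    · rintro rfl u w
      have h := abs_jacobiAlpha_sub_le hA (hu u) (hu w) 0 one_pos
        (by rw [krylovResidual_zero, hu]) (by rw [krylovResidual_zero, hu])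
      rwa [pow_zero, mul_one, div_one, hd] at h
    · intro κ hκ u w hκu hκw
      refine (abs_jacobiAlpha_sub_le hA (hu u) (hu w) i hκ hκu hκw).trans ?_
      rw [hd]
      gcongr
      norm_num
  · refine sphereUniform_real_lt_abs_sub_median_le_of_residual hn.ne' hA hδ hω hequi
      (fun u => ?_) ?_ ?_ hb ht
    · rw [abs_of_nonneg (jacobiBeta_nonneg A _ i)]
      exact jacobiBeta_le A (hu u) i
    · rintro rfl u w
      rw [← hd]
      exact abs_jacobiBeta_zero_sub_le hA (hu u) (hu w)
    · intro κ hκ u w hκu hκw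
      rw [← hd]
      exact abs_jacobiBeta_sub_le hA (hu u) (hu w) i hκ hκu hκw
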